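/- An asset has to be sold before a deadline that is $t\ge 0$ time units away. Offers arrive after independent durations $D_1,D_2,\dots$, exponentially distributed with rate $\lambda>0$; the offer sizes $X_1,X_2,\dots$ are i.i.d. with cumulative distribution function $F$; the residual price $X_0$ is a further random variable; and all of $D_1,D_2,\dots,X_0,X_1,X_2,\dots$ are independent. Assume $E[\max(X_1,0)]<\infty$, $E|X_0|<\infty$, and $0\le\mu_0<M$, where $\mu_0=E[X_0]$ and $M=\sup\{x: F(x)<1\}\in(-\infty,+\infty]$. Put $t_0=t$ and $t_i=\max(t_{i-1}-D_i,0)$ for $i\ge 1$. A policy is a measurable set of pairs (remaining time, offer), namely those at which the offer is accepted. Under a policy the process ends at the first $i\geq 1$ such that either $t_i=0$, in which case the sale price is $S_t=X_0$ and the time to sale is $T_t=t$, or $t_i>0$ and the offer $X_i$ is accepted at remaining time $t_i$, in which case $S_t=X_i$ and $T_t=t-t_i$. Let $\mu(t)$ be the supremum of $E[S_t]$ over all policies for which $S_t$ is integrable, and let $T_t$ be the time to sale under the optimal policy, which accepts an offer $x$ at remaining time $s$ if and only if $x\ge\mu(s)$. Put $$\phi(x)=\int_x^\infty[1-F(u)]\,du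 .$$ Then $T_t$ has a finite second moment, $$E[T_t]=\frac1\lambda\,\phi(\mu(t))\int_{\mu_0}^{\mu(t)}\frac{dw}{\phi(w)^2},$$ and $$\mathrm{Var}[T_t]=\frac1{\lambda^2}\left[2\phi(\mu(t))\int_{\mu_0}^{\mu(t)}\frac1{\phi(u)}\int_{\mu_0}^{u}\frac{1}{\phi(w)^2}\,dw\,du-\left(\phi(\mu(t))\int_{\mu_0}^{\mu(t)}\frac{dw}{\phi(w)^2}\right)^2\right].$$ -/

import Mathlib

open MeasureTheory ProbabilityTheory Set

noncomputable section

namespace Bidding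

/-- `φ(x) = ∫_x^∞ (1 - F(u)) du`, where `F` is the cumulative distribution function of the offer
distribution `ν`. -/
def phi (ν : Measure ℝ) (x : ℝ) : ℝ := ∫ u in Ioi x, (1 - cdf ν u)

/-- `M = sup {x | F(x) < 1}`, the right end of the support of the offer distribution `ν`
(it is `⊤` if the support is not bounded above). -/
def offerSup (ν : Measure ℝ) : EReal := sSup ((fun x : ℝ => (x : EReal)) '' {x | cdf ν x < 1})

section Rules

variable {Ω : Type*}

/-- The time that remains until the deadline at the arrival of the successive offers:
`t_0 = t` and `t_{n+1} = max (t_n - D_{n+1}) 0`. Durations and offers are indexed from `0` in the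
code: `D n` is the duration before the `(n+1)`-st offer, and `X n` is the size of that offer. -/
def remainingTime (D : ℕ → Ω → ℝ) (t : ℝ) (ω : Ω) : ℕ → ℝ
  | 0 => t
  | n + 1 => max (remainingTime D t ω n - D n ω) 0

/-- A policy is a set `A` of pairs (remaining time, offer), those at which the offer is accepted.
The bidding process ends at step `n` if the deadline has been reached or the offer `X n` is
accepted. -/
def EndsAt (A : Set (ℝ × ℝ)) (D X : ℕ → Ω → ℝ) (t : ℝ) (ω : Ω) (n : ℕ) : Prop :=
  remainingTime D t ω (n + 1) = 0 ∨ (remainingTime D t ω (n + 1), X n ω) ∈ A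

/-- The first step at which the process ends. (If the durations have a finite sum the process might
never end, and the value is then `0`; for exponential durations this is an event of
probability `0`.) -/
def endStep (A : Set (ℝ × ℝ)) (D X : ℕ → Ω → ℝ) (t : ℝ) (ω : Ω) : ℕ :=
  sInf {n | EndsAt A D X t ω n}

/-- The realized sale price under the policy `A`, with initial remaining time `t`: the residual
price `X₀` if the deadline is reached, and otherwise the accepted offer. -/
def salePrice (A : Set (ℝ × ℝ)) (D X : ℕ → Ω → ℝ) (X₀ : Ω → ℝ) (t : ℝ) (ω : Ω) : ℝ :=
  if remainingTime D t ω (endStep A D X t ω + 1) = 0 then X₀ ω else X (endStep A D X t ω) ω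

/-- The time to sale under the policy `A`, with initial remaining time `t` (it is `t` if the
deadline is reached, since no time remains then). -/
def timeToSale (A : Set (ℝ × ℝ)) (D X : ℕ → Ω → ℝ) (t : ℝ) (ω : Ω) : ℝ :=
  t - remainingTime D t ω (endStep A D X t ω + 1)

/-- The maximal expected sale price over all (measurable) policies, when the remaining time is `t`
and no offer is at hand. Only the positive part of an offer has to be integrable, so that
the expected sale price may be `-∞`; policies with this property are left out. -/
def optimalValue [MeasurableSpace Ω] (P : Measure Ω) (D X : ℕ → Ω → ℝ) (X₀ : Ω → ℝ) (t : ℝ) : ℝ :=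
  sSup {v | ∃ A : Set (ℝ × ℝ), MeasurableSet A ∧ Integrable (salePrice A D X X₀ t) P ∧
    v = ∫ ω, salePrice A D X X₀ t ω ∂P}

end Rules

/-- The policy that accepts an offer `x` with remaining time `s` if and only if `x ≥ μ(s)`. -/
def thresholdPolicy (μ : ℝ → ℝ) : Set (ℝ × ℝ) := {p | μ p.1 ≤ p.2}

end Bidding

end

/-!
The optimal value `μ` is identified with the solution `m` of the differential equation
`m' = rate * φ(m)`, `m(0) = μ₀`, and the distribution of the time to sale is then explicit: at
remaining time `r` offers are accepted at rate `rate * (1 - F(m r))` (the threshold is an atom of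
`F` for countably many `r` only), which is the logarithmic derivative of `1 / φ(m r)`, so that an
asset with remaining time `s` is still unsold at remaining time `r` with probability
`φ(m s) / φ(m r)`. Integrating this tail gives `E[T] = φ(m t) ∫ dr / φ(m r)` and
`E[T²] = 2 φ(m t) ∫ (t - r) / φ(m r) dr` over `[0, t]`, and the substitution `w = m r` turns these
into the stated formulas (`IsValueCurve.integral_one_div_phi_sq`,
`IsValueCurve.integral_integral_one_div_phi`).

Every expectation is computed by one verification argument, without conditional expectations. The
next duration and offer are independent of the remaining time and of the event that the process is
still alive, so the expectation over one step is an integral against the product of the exponential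
and the offer distribution (`IsBidModel.integral_alive_step`). If a function `h` of the remaining
time dominates the expected outcome of one step (`IsUpperValue`), then the reward collected so far
plus the value of continuing is a supermartingale, and as the probability of being alive tends to
zero, the expected reward is at most `h t` (`IsBidModel.integral_finalReward_le`). Equalities follow
by applying this to a reward and to its negative. It is used

* with `h = m`, for the price under an arbitrary policy, and with `h = -m` for the threshold policy,
  which gives `μ = m` on `[0, t]` (`IsBidModel.optimalValue_eq`); the residual price may be replaced
  by its mean since it is independent of the event that the deadline is reached;
* with `h s = k s - φ(m s) ∫ k' r / φ(m r) dr`, integrated over `[0, s]`, for the expectation of a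
  function `k` of the remaining time at the sale (`IsBidModel.integral_finalReward_time`).

That `h` matches the expected outcome of one step amounts to `h' = rate * (f - h)`, where `f` is the
expected outcome of an arrival (`integral_expMeasure_step`). Only right derivatives are available
for `φ`, as `F` may jump.
-/

namespace Bidding

variable {Ω : Type*}

/-! ### Pathwise facts about the bidding process -/

/-- The event that the process has not ended at any of the steps `0, …, n - 1`. -/
def aliveSet (A : Set (ℝ × ℝ)) (D X : ℕ → Ω → ℝ) (t : ℝ) (n : ℕ) : Set Ω :=
  {ω | ∀ k < n, ¬ EndsAt A D X t ω k}

/-- The reward `r (s, x)` collected at the end of the process, where `s` is the remaining time and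
`x` the last offer. Both the sale price (with `X₀` replaced by its mean) and the powers of the
time to sale are of this form. -/
noncomputable def finalReward (r : ℝ × ℝ → ℝ) (A : Set (ℝ × ℝ)) (D X : ℕ → Ω → ℝ) (t : ℝ)
    (ω : Ω) : ℝ :=
  r (remainingTime D t ω (endStep A D X t ω + 1), X (endStep A D X t ω) ω)

theorem endStep_eq {A : Set (ℝ × ℝ)} {D X : ℕ → Ω → ℝ} {t : ℝ} {ω : Ω} {n : ℕ}
    (hω : ω ∈ aliveSet A D X t n) (h : EndsAt A D X t ω n) : endStep A D X t ω = n := by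
  refine le_antisymm (Nat.sInf_le h) (le_csInf ⟨n, h⟩ fun k hk => ?_)
  by_contra hlt
  exact hω k (not_le.mp hlt) hk

theorem mem_aliveSet_succ {A : Set (ℝ × ℝ)} {D X : ℕ → Ω → ℝ} {t : ℝ} {ω : Ω} {n : ℕ} :
    ω ∈ aliveSet A D X t (n + 1) ↔ ω ∈ aliveSet A D X t n ∧ ¬ EndsAt A D X t ω n := by
  simp only [aliveSet, mem_ofPred_eq, Nat.lt_succ_iff_lt_or_eq]
  constructor
  · exact fun h => ⟨fun k hk => h k (.inl hk), h n (.inr rfl)⟩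
  · rintro ⟨h1, h2⟩ k (hk | rfl)
    exacts [h1 k hk, h2]

theorem endStep_lt {A : Set (ℝ × ℝ)} {D X : ℕ → Ω → ℝ} {t : ℝ} {ω : Ω} {n : ℕ}
    (hω : ω ∉ aliveSet A D X t n) : endStep A D X t ω < n := by
  simp only [aliveSet, mem_ofPred_eq, not_forall, not_not] at hω
  obtain ⟨k, hk, hE⟩ := hω
  exact lt_of_le_of_lt (Nat.sInf_le hE) hk

theorem remainingTime_mem_Icc {D : ℕ → Ω → ℝ} {t : ℝ} (ht : 0 ≤ t) {ω : Ω}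
    (hD : ∀ n, 0 ≤ D n ω) (n : ℕ) : remainingTime D t ω n ∈ Icc 0 t := by
  induction n with
  | zero => exact ⟨ht, le_rfl⟩
  | succ n ih =>
    exact ⟨le_max_right _ _, max_le (by linarith [ih.2, hD n]) ht⟩

theorem measurable_remainingTime [MeasurableSpace Ω] {D : ℕ → Ω → ℝ} {t : ℝ} {n : ℕ}
    (hD : ∀ k < n, Measurable (D k)) : Measurable fun ω => remainingTime D t ω n := by
  induction n with
  | zero => exact measurable_const
  | succ n ih =>
    exact ((ih fun k hk => hD k (hk.trans n.lt_succ_self)).sub (hD n n.lt_succ_self)).max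
      measurable_const

theorem measurableSet_endsAt [MeasurableSpace Ω] {A : Set (ℝ × ℝ)} (hA : MeasurableSet A)
    {D X : ℕ → Ω → ℝ} {t : ℝ} {n : ℕ} (hD : ∀ k ≤ n, Measurable (D k))
    (hX : Measurable (X n)) : MeasurableSet {ω | EndsAt A D X t ω n} := by
  have h := measurable_remainingTime (t := t) (n := n + 1)
    fun k hk => hD k (Nat.lt_succ_iff.mp hk)
  exact (h (measurableSet_singleton 0)).union ((h.prodMk hX) hA)

theorem measurableSet_aliveSet [MeasurableSpace Ω] {A : Set (ℝ × ℝ)} (hA : MeasurableSet A)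
    {D X : ℕ → Ω → ℝ} {t : ℝ} {n : ℕ} (hD : ∀ k < n, Measurable (D k))
    (hX : ∀ k < n, Measurable (X k)) : MeasurableSet (aliveSet A D X t n) := by
  have : aliveSet A D X t n = ⋂ k, ⋂ (_ : k < n), {ω | EndsAt A D X t ω k}ᶜ := by
    ext ω; simp [aliveSet]
  rw [this]
  exact .iInter fun k => .iInter fun hk =>
    (measurableSet_endsAt hA (fun j hj => hD j (hj.trans_lt hk)) (hX k hk)).compl

theorem measurable_endStep [MeasurableSpace Ω] {A : Set (ℝ × ℝ)} (hA : MeasurableSet A)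
    {D X : ℕ → Ω → ℝ} {t : ℝ} (hD : ∀ n, Measurable (D n)) (hX : ∀ n, Measurable (X n)) :
    Measurable (endStep A D X t) := by
  have hE : ∀ n, MeasurableSet {ω | EndsAt A D X t ω n} :=
    fun n => measurableSet_endsAt hA (fun k _ => hD k) (hX n)
  have hal : ∀ n, MeasurableSet (aliveSet A D X t n) :=
    fun n => measurableSet_aliveSet hA (fun k _ => hD k) (fun k _ => hX k)
  refine measurable_to_countable' fun n => ?_
  have : endStep A D X t ⁻¹' {n} = (aliveSet A D X t n ∩ {ω | EndsAt A D X t ω n}) ∪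
      {ω | (∀ k, ω ∈ aliveSet A D X t k) ∧ n = 0} := by
    ext ω
    simp only [mem_preimage, mem_singleton_iff, mem_union, mem_inter_iff, mem_ofPred_eq]
    constructor
    · rintro rfl
      rcases ({n | EndsAt A D X t ω n}).eq_empty_or_nonempty with h | h
      · refine .inr ⟨fun k j _ hj => ?_, by simp [endStep, h]⟩
        exact (h ▸ hj : j ∈ (∅ : Set ℕ))
      · exact .inl ⟨fun k hk => Nat.notMem_of_lt_sInf hk, Nat.sInf_mem h⟩
    · rintro (⟨h1, h2⟩ | ⟨h, rfl⟩)
      · exact endStep_eq h1 h2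
      · have : {n | EndsAt A D X t ω n} = ∅ :=
          eq_empty_of_forall_notMem fun k hk => h (k + 1) k k.lt_succ_self hk
        simp [endStep, this]
  rw [this]
  refine ((hal n).inter (hE n)).union ?_
  by_cases hn : n = 0
  · simp only [hn, and_true, ofPred_forall]
    exact .iInter hal
  · simp [hn]

theorem measurable_finalReward [MeasurableSpace Ω] {r : ℝ × ℝ → ℝ} (hr : Measurable r)
    {A : Set (ℝ × ℝ)} (hA : MeasurableSet A) {D X : ℕ → Ω → ℝ} {t : ℝ}
    (hD : ∀ n, Measurable (D n)) (hX : ∀ n, Measurable (X n)) :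
    Measurable (finalReward r A D X t) := by
  have h : Measurable fun p : ℕ × Ω => r (remainingTime D t p.2 (p.1 + 1), X p.1 p.2) :=
    measurable_from_prod_countable_right fun n =>
      hr.comp ((measurable_remainingTime (n := n + 1) fun k _ => hD k).prodMk (hX n))
  exact h.comp ((measurable_endStep hA hD hX).prodMk measurable_id)

/-! ### One step of the process -/

/-- The probabilistic assumptions: independent durations with the exponential distribution and
offers with the distribution `ν`, together with an independent residual price `X₀`. -/
structure IsBidModel [MeasurableSpace Ω] (P : Measure Ω) (rate : ℝ) (ν : Measure ℝ)
    (D X : ℕ → Ω → ℝ) (X₀ : Ω → ℝ) : Prop where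
  rate_pos : 0 < rate
  measurable_duration : ∀ n, Measurable (D n)
  measurable_offer : ∀ n, Measurable (X n)
  measurable_residual : Measurable X₀
  map_duration : ∀ n, P.map (D n) = expMeasure rate
  map_offer : ∀ n, P.map (X n) = ν
  indep : iIndepFun (Sum.elim D (Sum.elim X (fun _ : Unit => X₀))) P

theorem expMeasure_Iio_zero (rate : ℝ) : expMeasure rate (Iio 0) = 0 := by
  rw [expMeasure, gammaMeasure, withDensity_apply _ measurableSet_Iio,
    setLIntegral_congr_fun measurableSet_Iio (g := fun _ => 0)
      fun x hx => gammaPDF_of_neg hx]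
  simp

/-- The σ-algebra generated by the members of the family of durations, offers and residual price
whose index belongs to `S`. -/
abbrev partSigma (D X : ℕ → Ω → ℝ) (X₀ : Ω → ℝ) (S : Set (ℕ ⊕ (ℕ ⊕ Unit))) : MeasurableSpace Ω :=
  ⨆ i ∈ S, MeasurableSpace.comap (Sum.elim D (Sum.elim X (fun _ : Unit => X₀)) i) inferInstance

theorem measurable_part {D X : ℕ → Ω → ℝ} {X₀ : Ω → ℝ} {S : Set (ℕ ⊕ (ℕ ⊕ Unit))}
    {i : ℕ ⊕ (ℕ ⊕ Unit)} (hi : i ∈ S) :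
    Measurable[partSigma D X X₀ S] (Sum.elim D (Sum.elim X (fun _ : Unit => X₀)) i) :=
  (comap_measurable _).mono (le_iSup₂_of_le i hi le_rfl) le_rfl

namespace IsBidModel

variable [MeasurableSpace Ω] {P : Measure Ω} {rate : ℝ} {ν : Measure ℝ}
  {D X : ℕ → Ω → ℝ} {X₀ : Ω → ℝ} {A : Set (ℝ × ℝ)} {t : ℝ}

theorem ae_nonneg (H : IsBidModel P rate ν D X X₀) : ∀ᵐ ω ∂P, ∀ n, 0 ≤ D n ω := by
  refine ae_all_iff.mpr fun n => ?_
  have h : P (D n ⁻¹' Iio 0) = 0 := by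
    rw [← Measure.map_apply (H.measurable_duration n) measurableSet_Iio, H.map_duration,
      expMeasure_Iio_zero]
  refine measure_mono_null (fun ω hω => ?_) h
  simpa using hω

theorem measurable_family (H : IsBidModel P rate ν D X X₀) (i : ℕ ⊕ (ℕ ⊕ Unit)) :
    Measurable (Sum.elim D (Sum.elim X (fun _ : Unit => X₀)) i) := by
  rcases i with i | i | i
  exacts [H.measurable_duration i, H.measurable_offer i, H.measurable_residual]

/-- Functions of disjoint parts of the family of durations, offers and residual price are
independent. -/
theorem indepFun_of_disjoint (H : IsBidModel P rate ν D X X₀) {α β : Type*}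
    [MeasurableSpace α] [MeasurableSpace β] {S S' : Set (ℕ ⊕ (ℕ ⊕ Unit))} (hS : Disjoint S S')
    {V : Ω → α} {W : Ω → β} (hV : Measurable[partSigma D X X₀ S] V)
    (hW : Measurable[partSigma D X X₀ S'] W) : IndepFun V W P := by
  have h := indep_iSup_of_disjoint (fun i => (H.measurable_family i).comap_le)
    H.indep.iIndep hS
  rw [IndepFun_iff_Indep]
  exact indep_of_indep_of_le_left (indep_of_indep_of_le_right h hW.comap_le) hV.comap_le

/-- The remaining time at step `n`, and whether the process is still alive then, are independent of
the next duration and offer. -/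
theorem indepFun_past_next (H : IsBidModel P rate ν D X X₀) (hA : MeasurableSet A) (n : ℕ) :
    IndepFun (fun ω => (remainingTime D t ω n, (aliveSet A D X t n).indicator (1 : Ω → ℝ) ω))
      (fun ω => (D n ω, X n ω)) P := by
  let S : Set (ℕ ⊕ (ℕ ⊕ Unit)) := Sum.inl '' Iio n ∪ (Sum.inr ∘ Sum.inl) '' Iio n
  let S' : Set (ℕ ⊕ (ℕ ⊕ Unit)) := {Sum.inl n, Sum.inr (Sum.inl n)}
  have hS : Disjoint S S' := by
    refine Set.disjoint_left.mpr ?_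
    rintro i (⟨k, hk, rfl⟩ | ⟨k, hk, rfl⟩) h <;>
      simp only [S', mem_insert_iff, mem_singleton_iff, Function.comp_apply, Sum.inl.injEq,
        Sum.inr.injEq, reduceCtorEq, or_false, false_or] at h <;>
      exact (mem_Iio.mp hk).ne h
  have hD : ∀ k < n, Measurable[partSigma D X X₀ S] (D k) := fun k hk =>
    measurable_part (i := Sum.inl k) (.inl ⟨k, hk, rfl⟩)
  have hX : ∀ k < n, Measurable[partSigma D X X₀ S] (X k) := fun k hk =>
    measurable_part (i := Sum.inr (Sum.inl k)) (.inr ⟨k, hk, rfl⟩)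
  have hD' : Measurable[partSigma D X X₀ S'] (D n) :=
    measurable_part (i := Sum.inl n) (by simp [S'])
  have hX' : Measurable[partSigma D X X₀ S'] (X n) :=
    measurable_part (i := Sum.inr (Sum.inl n)) (by simp [S'])
  refine H.indepFun_of_disjoint hS (Measurable.prodMk ?_ ?_) (hD'.prodMk hX')
  · exact @measurable_remainingTime Ω (partSigma D X X₀ S) D t n hD
  · exact Measurable.indicator (f := fun _ => (1 : ℝ)) measurable_const
      (@measurableSet_aliveSet Ω (partSigma D X X₀ S) A hA D X t n hD hX)

variable [IsProbabilityMeasure P]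

/-- If `h s` is the expected value of `Φ` after one step that starts with remaining time `s`, then
on the event that the process is alive at step `n`, `Φ` of the next step may be replaced by `h` of
the current remaining time. -/
theorem integral_alive_step (H : IsBidModel P rate ν D X X₀) (hA : MeasurableSet A) (ht : 0 ≤ t)
    {Φ : ℝ × (ℝ × ℝ) → ℝ} (hΦ : Measurable Φ) {n : ℕ}
    (hint : Integrable (fun ω => Φ (remainingTime D t ω n, D n ω, X n ω)) P) {h : ℝ → ℝ}
    (hh : ∀ s ∈ Icc 0 t, ∫ p, Φ (s, p) ∂((expMeasure rate).prod ν) = h s) :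
    ∫ ω, (aliveSet A D X t n).indicator
        (fun ω => Φ (remainingTime D t ω n, D n ω, X n ω)) ω ∂P =
      ∫ ω, (aliveSet A D X t n).indicator (fun ω => h (remainingTime D t ω n)) ω ∂P := by
  have : IsProbabilityMeasure (expMeasure rate) := isProbabilityMeasure_expMeasure H.rate_pos
  have : IsProbabilityMeasure ν := by
    rw [← H.map_offer 0]; exact Measure.isProbabilityMeasure_map (H.measurable_offer 0).aemeasurable
  have hal := measurableSet_aliveSet (t := t) (n := n) hA
    (fun k _ => H.measurable_duration k) (fun k _ => H.measurable_offer k)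
  have hV : Measurable fun ω =>
      (remainingTime D t ω n, (aliveSet A D X t n).indicator (1 : Ω → ℝ) ω) :=
    (measurable_remainingTime fun k _ => H.measurable_duration k).prodMk
      (measurable_one.indicator hal)
  have hW : Measurable fun ω => (D n ω, X n ω) :=
    (H.measurable_duration n).prodMk (H.measurable_offer n)
  have hlaw : P.map (fun ω => (D n ω, X n ω)) = (expMeasure rate).prod ν := by
    have := H.indep.indepFun (i := Sum.inl n) (j := Sum.inr (Sum.inl n)) (by simp)
    have := (indepFun_iff_map_prod_eq_prod_map_map (H.measurable_duration n).aemeasurable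
      (H.measurable_offer n).aemeasurable).mp this
    rw [this, H.map_duration, H.map_offer]
  have hjoint := (indepFun_iff_map_prod_eq_prod_map_map hV.aemeasurable hW.aemeasurable).mp
    (H.indepFun_past_next (t := t) hA n)
  rw [hlaw] at hjoint
  let G : (ℝ × ℝ) × (ℝ × ℝ) → ℝ := fun q => q.1.2 * Φ (q.1.1, q.2)
  have hG : Measurable G := by fun_prop
  have hind : ∀ (f : Ω → ℝ) (ω : Ω), (aliveSet A D X t n).indicator f ω =
      (aliveSet A D X t n).indicator (1 : Ω → ℝ) ω * f ω := fun f ω => by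
    by_cases hω : ω ∈ aliveSet A D X t n <;> simp [hω]
  have hGint : Integrable G (P.map fun ω =>
      ((remainingTime D t ω n, (aliveSet A D X t n).indicator (1 : Ω → ℝ) ω), D n ω, X n ω)) := by
    rw [integrable_map_measure hG.aestronglyMeasurable (hV.prodMk hW).aemeasurable]
    refine (hint.indicator hal).congr (.of_forall fun ω => ?_)
    exact hind _ ω
  calc _ = ∫ ω, G ((remainingTime D t ω n, (aliveSet A D X t n).indicator (1 : Ω → ℝ) ω),
        D n ω, X n ω) ∂P := integral_congr_ae (.of_forall fun ω => hind _ ω)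
    _ = ∫ q, G q ∂(P.map fun ω =>
        ((remainingTime D t ω n, (aliveSet A D X t n).indicator (1 : Ω → ℝ) ω), D n ω, X n ω)) :=
      (integral_map (hV.prodMk hW).aemeasurable hG.aestronglyMeasurable).symm
    _ = ∫ v, ∫ w, G (v, w) ∂((expMeasure rate).prod ν) ∂(P.map fun ω =>
        (remainingTime D t ω n, (aliveSet A D X t n).indicator (1 : Ω → ℝ) ω)) := by
      rw [hjoint] at hGint ⊢
      exact integral_prod _ hGint
    _ = ∫ ω, ∫ w, G ((remainingTime D t ω n, (aliveSet A D X t n).indicator (1 : Ω → ℝ) ω), w)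
        ∂((expMeasure rate).prod ν) ∂P :=
      integral_map hV.aemeasurable
        (hG.stronglyMeasurable.integral_prod_right').aestronglyMeasurable
    _ = _ := by
      refine integral_congr_ae ?_
      filter_upwards [H.ae_nonneg] with ω hω
      simp only [G]
      rw [integral_const_mul, hh _ (remainingTime_mem_Icc ht hω n)]
      exact (hind (fun ω => h (remainingTime D t ω n)) ω).symm

/-- The probability that the process is alive decreases geometrically, as each duration exceeds `t`
with a fixed positive probability. -/
theorem tendsto_measureReal_aliveSet (H : IsBidModel P rate ν D X X₀) (hA : MeasurableSet A)
    (ht : 0 ≤ t) :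
    Filter.Tendsto (fun n => P.real (aliveSet A D X t n)) Filter.atTop (nhds 0) := by
  have : IsProbabilityMeasure (expMeasure rate) := isProbabilityMeasure_expMeasure H.rate_pos
  have : IsProbabilityMeasure ν := by
    rw [← H.map_offer 0]; exact Measure.isProbabilityMeasure_map (H.measurable_offer 0).aemeasurable
  set q := (expMeasure rate).real (Iio t)
  have hal := fun n => measurableSet_aliveSet (t := t) (n := n) hA
    (fun k _ => H.measurable_duration k) (fun k _ => H.measurable_offer k)
  have hstep : ∀ n, P.real (aliveSet A D X t (n + 1)) ≤ q * P.real (aliveSet A D X t n) := by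
    intro n
    have hm : MeasurableSet {p : ℝ × (ℝ × ℝ) | p.2.1 < t} :=
      measurableSet_lt (by fun_prop) measurable_const
    have hmD : MeasurableSet {ω | D n ω < t} :=
      measurableSet_lt (H.measurable_duration n) measurable_const
    have key := H.integral_alive_step (n := n) hA ht
      (Φ := {p : ℝ × (ℝ × ℝ) | p.2.1 < t}.indicator 1) (h := fun _ => q)
      (measurable_one.indicator hm)
      ((integrable_const (1 : ℝ)).indicator hmD) (fun s _ => by
        have : (fun p : ℝ × ℝ =>
            {p : ℝ × (ℝ × ℝ) | p.2.1 < t}.indicator (1 : ℝ × (ℝ × ℝ) → ℝ) (s, p)) =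
            (Iio t ×ˢ univ).indicator 1 := by
          ext p; simp [indicator]
        rw [this, integral_indicator_one (measurableSet_Iio.prod .univ)]
        simp [measureReal_prod_prod, q])
    rw [integral_indicator (hal n) (f := fun _ => q), setIntegral_const, smul_eq_mul,
      mul_comm] at key
    rw [← key, ← integral_indicator_one (hal (n + 1))]
    refine integral_mono_ae ((integrable_const (1 : ℝ)).indicator (hal _))
      (((integrable_const (1 : ℝ)).indicator hmD).indicator (hal _)) ?_
    filter_upwards [H.ae_nonneg] with ω hω
    by_cases h : ω ∈ aliveSet A D X t (n + 1)
    · obtain ⟨h1, h2⟩ := mem_aliveSet_succ.mp h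
      have h3 : D n ω < t := by
        by_contra hge
        refine h2 (.inl (max_eq_right ?_))
        linarith [(remainingTime_mem_Icc ht hω n).2]
      simp [indicator, h, h1, h3]
    · rw [indicator_of_notMem h]
      exact indicator_nonneg (fun _ _ => indicator_nonneg (fun _ _ => zero_le_one) _) _
  have hq : q < 1 := by
    have h1 : q ≤ cdf (expMeasure rate) t := by
      rw [cdf_eq_real]; exact measureReal_mono Iio_subset_Iic_self
    rw [cdf_expMeasure_eq H.rate_pos, if_pos ht] at h1
    linarith [Real.exp_pos (-(rate * t))]
  have hle : ∀ n, P.real (aliveSet A D X t n) ≤ q ^ n := by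
    intro n
    induction n with
    | zero => simp
    | succ n ih =>
      rw [pow_succ']
      exact (hstep n).trans (mul_le_mul_of_nonneg_left ih measureReal_nonneg)
  exact squeeze_zero (fun _ => measureReal_nonneg) hle
    (tendsto_pow_atTop_nhds_zero_of_lt_one measureReal_nonneg hq)

end IsBidModel
end Bidding

namespace Bidding

variable {Ω : Type*}

/-! ### Verification of value functions -/

/-- A value function `h` for a reward `r` under the policy `A`, in the weak sense of an upper
bound: there is a function `Φ` of the remaining time and of the next duration and offer that
dominates the outcome of the next step, and whose expectation is `h`. -/
structure IsUpperValue (rate : ℝ) (ν : Measure ℝ) (A : Set (ℝ × ℝ)) (t : ℝ) (r : ℝ × ℝ → ℝ)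
    (h : ℝ → ℝ) (Φ : ℝ × (ℝ × ℝ) → ℝ) (C : ℝ) : Prop where
  measurable_value : Measurable h
  measurable_step : Measurable Φ
  abs_value_le : ∀ s ∈ Icc 0 t, |h s| ≤ C
  abs_step_le : ∀ s ∈ Icc 0 t, ∀ d ≥ 0, ∀ x, |Φ (s, d, x)| ≤ C + max x 0
  integral_step : ∀ s ∈ Icc 0 t, ∫ p, Φ (s, p) ∂((expMeasure rate).prod ν) = h s
  reward_le : ∀ s ∈ Icc 0 t, ∀ d ≥ 0, ∀ x, (max (s - d) 0 = 0 ∨ (max (s - d) 0, x) ∈ A) →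
    r (max (s - d) 0, x) ≤ Φ (s, d, x)
  value_le : ∀ s ∈ Icc 0 t, ∀ d ≥ 0, ∀ x, ¬ (max (s - d) 0 = 0 ∨ (max (s - d) 0, x) ∈ A) →
    h (max (s - d) 0) ≤ Φ (s, d, x)

namespace IsBidModel

variable [MeasurableSpace Ω] {P : Measure Ω} {rate : ℝ} {ν : Measure ℝ}
  {D X : ℕ → Ω → ℝ} {X₀ : Ω → ℝ} {A : Set (ℝ × ℝ)} {t : ℝ}

theorem measurableSet_aliveSet (H : IsBidModel P rate ν D X X₀) (hA : MeasurableSet A) (n : ℕ) :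
    MeasurableSet (aliveSet A D X t n) :=
  Bidding.measurableSet_aliveSet hA (fun k _ => H.measurable_duration k)
    (fun k _ => H.measurable_offer k)

theorem integrable_offer_posPart (H : IsBidModel P rate ν D X X₀)
    (hν : Integrable (fun x : ℝ => max x 0) ν) (n : ℕ) :
    Integrable (fun ω => max (X n ω) 0) P := by
  rw [← H.map_offer n] at hν
  exact hν.comp_measurable (H.measurable_offer n)

variable [IsProbabilityMeasure P]

/-- The process ends almost surely, so the events of having ended before step `n` exhaust the
sample space. -/
theorem aecover_ended (H : IsBidModel P rate ν D X X₀) (hA : MeasurableSet A) (ht : 0 ≤ t) :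
    AECover P Filter.atTop fun n => (aliveSet A D X t n)ᶜ where
  measurableSet n := (H.measurableSet_aliveSet hA n).compl
  ae_eventually_mem := by
    have h0 : P.real (⋂ n, aliveSet A D X t n) = 0 :=
      le_antisymm (ge_of_tendsto' (H.tendsto_measureReal_aliveSet hA ht) fun n =>
        measureReal_mono (iInter_subset _ n)) measureReal_nonneg
    rw [measureReal_eq_zero_iff] at h0
    filter_upwards [compl_mem_ae_iff.mpr h0] with ω hω
    simp only [mem_compl_iff, mem_iInter, not_forall] at hω
    obtain ⟨n, hn⟩ := hω
    filter_upwards [Filter.eventually_ge_atTop n] with k hk hmem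
    exact hn fun j hj => hmem j (hj.trans_le hk)

variable {r : ℝ × ℝ → ℝ} {h : ℝ → ℝ} {Φ : ℝ × (ℝ × ℝ) → ℝ} {C : ℝ}

theorem integrable_value (H : IsBidModel P rate ν D X X₀) (ht : 0 ≤ t)
    (hV : IsUpperValue rate ν A t r h Φ C) (n : ℕ) :
    Integrable (fun ω => h (remainingTime D t ω n)) P := by
  refine Integrable.of_bound (C := C) (hV.measurable_value.comp
    (measurable_remainingTime fun k _ => H.measurable_duration k)).aestronglyMeasurable ?_
  filter_upwards [H.ae_nonneg] with ω hω
  exact hV.abs_value_le _ (remainingTime_mem_Icc ht hω n)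

theorem integrable_step (H : IsBidModel P rate ν D X X₀) (ht : 0 ≤ t)
    (hν : Integrable (fun x : ℝ => max x 0) ν) (hV : IsUpperValue rate ν A t r h Φ C) (n : ℕ) :
    Integrable (fun ω => Φ (remainingTime D t ω n, D n ω, X n ω)) P := by
  refine ((integrable_const C).add (H.integrable_offer_posPart hν n)).mono'
    (hV.measurable_step.comp ((measurable_remainingTime fun k _ => H.measurable_duration k).prodMk
      ((H.measurable_duration n).prodMk (H.measurable_offer n)))).aestronglyMeasurable ?_
  filter_upwards [H.ae_nonneg] with ω hω
  exact hV.abs_step_le _ (remainingTime_mem_Icc ht hω n) _ (hω n) _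

/-- The expected reward collected before step `n`, together with the expected value of continuing
from there, is at most the initial value: these sums form a supermartingale. -/
theorem setIntegral_value_add_reward_le (H : IsBidModel P rate ν D X X₀) (hA : MeasurableSet A)
    (ht : 0 ≤ t) (hν : Integrable (fun x : ℝ => max x 0) ν)
    (hV : IsUpperValue rate ν A t r h Φ C)
    (hint : ∀ n, IntegrableOn (finalReward r A D X t) (aliveSet A D X t n)ᶜ P) (n : ℕ) :
    ∫ ω in aliveSet A D X t n, h (remainingTime D t ω n) ∂P +
      ∫ ω in (aliveSet A D X t n)ᶜ, finalReward r A D X t ω ∂P ≤ h t := by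
  have hal := fun n => H.measurableSet_aliveSet (t := t) hA n
  induction n with
  | zero =>
    have : aliveSet A D X t 0 = univ := by ext; simp [aliveSet]
    simp [this, remainingTime]
  | succ n ih =>
    refine le_trans ?_ ih
    have hstep := H.integral_alive_step hA ht hV.measurable_step (n := n)
      (H.integrable_step ht hν hV n) hV.integral_step
    rw [integral_indicator (hal n), integral_indicator (hal n)] at hstep
    rw [← hstep, ← integral_indicator (hal n), ← integral_indicator (hal n).compl,
      ← integral_indicator (hal (n + 1)), ← integral_indicator (hal (n + 1)).compl]
    have i1 := (H.integrable_value ht hV (n + 1)).indicator (hal (n + 1))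
    have i2 := (hint (n + 1)).integrable_indicator (hal (n + 1)).compl
    have i3 := (H.integrable_step ht hν hV n).indicator (hal n)
    have i4 := (hint n).integrable_indicator (hal n).compl
    rw [← integral_add i1 i2, ← integral_add i3 i4]
    refine integral_mono_ae (i1.add i2) (i3.add i4) ?_
    filter_upwards [H.ae_nonneg] with ω hω
    have hs := remainingTime_mem_Icc ht hω n
    by_cases h1 : ω ∈ aliveSet A D X t n
    · by_cases h2 : EndsAt A D X t ω n
      · have h3 : ω ∉ aliveSet A D X t (n + 1) := fun h => (mem_aliveSet_succ.mp h).2 h2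
        simpa [h1, h3, finalReward, endStep_eq h1 h2, remainingTime] using
          hV.reward_le _ hs _ (hω n) _ h2
      · have h3 : ω ∈ aliveSet A D X t (n + 1) := mem_aliveSet_succ.mpr ⟨h1, h2⟩
        simpa [h1, h3, remainingTime] using hV.value_le _ hs _ (hω n) _ h2
    · have h3 : ω ∉ aliveSet A D X t (n + 1) := fun h => h1 (mem_aliveSet_succ.mp h).1
      simp [h1, h3]

theorem abs_setIntegral_value_le (H : IsBidModel P rate ν D X X₀) (ht : 0 ≤ t)
    (hV : IsUpperValue rate ν A t r h Φ C) (n : ℕ) :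
    |∫ ω in aliveSet A D X t n, h (remainingTime D t ω n) ∂P| ≤
      C * P.real (aliveSet A D X t n) := by
  rw [← Real.norm_eq_abs]
  refine norm_setIntegral_le_of_norm_le_const_ae (measure_lt_top P _) ?_
  filter_upwards [ae_restrict_of_ae H.ae_nonneg] with ω hω
  exact hV.abs_value_le _ (remainingTime_mem_Icc ht hω n)

theorem integral_finalReward_le (H : IsBidModel P rate ν D X X₀) (hA : MeasurableSet A)
    (ht : 0 ≤ t) (hν : Integrable (fun x : ℝ => max x 0) ν)
    (hV : IsUpperValue rate ν A t r h Φ C) (hint : Integrable (finalReward r A D X t) P) :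
    ∫ ω, finalReward r A D X t ω ∂P ≤ h t := by
  have hlim := (H.aecover_ended (t := t) hA ht).integral_tendsto_of_countably_generated hint
  have hlim' : Filter.Tendsto (fun n => h t + C * P.real (aliveSet A D X t n)) Filter.atTop
      (nhds (h t)) := by
    simpa using ((H.tendsto_measureReal_aliveSet hA ht).const_mul C).const_add (h t)
  refine le_of_tendsto_of_tendsto' hlim hlim' fun n => ?_
  have h1 := H.setIntegral_value_add_reward_le hA ht hν hV (fun _ => hint.integrableOn) n
  have h2 := neg_le_of_abs_le (H.abs_setIntegral_value_le ht hV n)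
  linarith

/-- A nonnegative reward that is bounded by the offers is integrable as soon as it has an upper
value function, by monotone convergence. -/
theorem integrable_finalReward (H : IsBidModel P rate ν D X X₀) (hA : MeasurableSet A)
    (ht : 0 ≤ t) (hν : Integrable (fun x : ℝ => max x 0) ν)
    (hV : IsUpperValue rate ν A t r h Φ C) (hr : Measurable r) {c : ℝ} (hc : 0 ≤ c)
    (hR : ∀ᵐ ω ∂P, 0 ≤ finalReward r A D X t ω)
    (hRX : ∀ᵐ ω ∂P, finalReward r A D X t ω ≤ c + max (X (endStep A D X t ω) ω) 0) :
    Integrable (finalReward r A D X t) P := by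
  have hcov := H.aecover_ended (t := t) hA ht
  have hint : ∀ n, IntegrableOn (finalReward r A D X t) (aliveSet A D X t n)ᶜ P := by
    intro n
    rw [← integrable_indicator_iff (H.measurableSet_aliveSet hA n).compl]
    refine ((integrable_const c).add (integrable_finsetSum (Finset.range n) fun k _ =>
      H.integrable_offer_posPart hν k)).mono' ((measurable_finalReward hr hA
        H.measurable_duration H.measurable_offer).indicator
          (H.measurableSet_aliveSet hA n).compl).aestronglyMeasurable ?_
    filter_upwards [hR, hRX] with ω h1 h2
    have hsum : ∀ k ∈ Finset.range n, 0 ≤ max (X k ω) 0 := fun k _ => le_max_right _ _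
    by_cases hω : ω ∈ (aliveSet A D X t n)ᶜ
    · rw [indicator_of_mem hω, Real.norm_of_nonneg h1]
      refine h2.trans (add_le_add_right ?_ c)
      exact Finset.single_le_sum hsum (Finset.mem_range.mpr (endStep_lt hω))
    · rw [indicator_of_notMem hω, norm_zero]
      exact add_nonneg hc (Finset.sum_nonneg hsum)
  refine hcov.integrable_of_integral_bounded_of_nonneg_ae (h t + C) hint hR
    (.of_forall fun n => ?_)
  have h1 := H.setIntegral_value_add_reward_le hA ht hν hV hint n
  have h2 := neg_le_of_abs_le (H.abs_setIntegral_value_le ht hV n)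
  have hC : 0 ≤ C := (abs_nonneg _).trans (hV.abs_value_le 0 ⟨le_rfl, ht⟩)
  have h3 : C * P.real (aliveSet A D X t n) ≤ C :=
    mul_le_of_le_one_right hC measureReal_le_one
  linarith

end IsBidModel
end Bidding

namespace Bidding

/-! ### The function `φ` -/

section Phi

variable {ν : Measure ℝ}

theorem phi_nonneg (x : ℝ) : 0 ≤ phi ν x :=
  integral_nonneg fun u => sub_nonneg.mpr (cdf_le_one ν u)

theorem intervalIntegrable_one_sub_cdf (x y : ℝ) :
    IntervalIntegrable (fun u => 1 - cdf ν u) volume x y :=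
  intervalIntegrable_const.sub (monotone_cdf ν).intervalIntegrable

variable [IsProbabilityMeasure ν]

theorem measureReal_Ioi_eq (x : ℝ) : ν.real (Ioi x) = 1 - cdf ν x := by
  rw [cdf_eq_real, ← compl_Iic, probReal_compl_eq_one_sub measurableSet_Iic]

theorem integrable_max_sub (hν : Integrable (fun x : ℝ => max x 0) ν) (x : ℝ) :
    Integrable (fun y => max (y - x) 0) ν := by
  refine (hν.add (integrable_const |x|)).mono' (by fun_prop) (.of_forall fun y => ?_)
  rw [Real.norm_of_nonneg (le_max_right _ _)]
  simp only [Pi.add_apply]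
  refine max_le ?_ (add_nonneg (le_max_right _ _) (abs_nonneg _))
  linarith [le_max_left y 0, neg_abs_le x]

/-- The layer cake formula for the positive part of `y - x`. -/
theorem lintegral_max_sub (x : ℝ) :
    ∫⁻ y, ENNReal.ofReal (max (y - x) 0) ∂ν = ∫⁻ u in Ioi x, ENNReal.ofReal (1 - cdf ν u) := by
  rw [lintegral_eq_lintegral_meas_lt ν (f := fun y => max (y - x) 0)
    (.of_forall fun y => le_max_right _ _) (by fun_prop)]
  have hm : Measurable fun u => ENNReal.ofReal (1 - cdf ν u) :=
    (measurable_const.sub (monotone_cdf ν).measurable).ennreal_ofReal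
  have hpre : (fun u => x + u) ⁻¹' Ioi x = Ioi 0 := by ext u; simp
  rw [← (measurePreserving_add_left volume x).setLIntegral_comp_preimage measurableSet_Ioi
    hm, hpre]
  refine setLIntegral_congr_fun measurableSet_Ioi fun u hu => ?_
  have : {y : ℝ | u < max (y - x) 0} = Ioi (x + u) := by
    ext y
    have : ¬ u < 0 := not_lt.mpr (le_of_lt hu)
    simp [lt_sub_iff_add_lt', this]
  simp only [this]
  rw [← measureReal_Ioi_eq, ofReal_measureReal]

theorem integrableOn_one_sub_cdf (hν : Integrable (fun x : ℝ => max x 0) ν) (x : ℝ) :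
    IntegrableOn (fun u => 1 - cdf ν u) (Ioi x) := by
  refine ⟨(measurable_const.sub (monotone_cdf ν).measurable).aestronglyMeasurable, ?_⟩
  rw [hasFiniteIntegral_iff_ofReal (.of_forall fun u => sub_nonneg.mpr (cdf_le_one ν u)),
    ← lintegral_max_sub]
  exact (integrable_max_sub hν x).lintegral_lt_top

/-- `φ(x)` is the expected excess of an offer over `x`. -/
theorem phi_eq_integral_max (x : ℝ) :
    phi ν x = ∫ y, max (y - x) 0 ∂ν := by
  rw [phi, integral_eq_lintegral_of_nonneg_ae
      (.of_forall fun u => sub_nonneg.mpr (cdf_le_one ν u))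
      (measurable_const.sub (monotone_cdf ν).measurable).aestronglyMeasurable,
    integral_eq_lintegral_of_nonneg_ae (f := fun y => max (y - x) 0)
      (.of_forall fun y => le_max_right _ _) (by fun_prop),
    lintegral_max_sub]

theorem phi_sub_phi (hν : Integrable (fun x : ℝ => max x 0) ν) (x y : ℝ) :
    phi ν x - phi ν y = ∫ u in x..y, (1 - cdf ν u) :=
  intervalIntegral.integral_Ioi_sub_Ioi' (integrableOn_one_sub_cdf hν x)
    (integrableOn_one_sub_cdf hν y)

theorem antitone_phi (hν : Integrable (fun x : ℝ => max x 0) ν) : Antitone (phi ν) := by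
  intro x y hxy
  rw [← sub_nonneg, phi_sub_phi hν]
  exact intervalIntegral.integral_nonneg hxy fun u _ => sub_nonneg.mpr (cdf_le_one ν u)

theorem lipschitzWith_phi (hν : Integrable (fun x : ℝ => max x 0) ν) :
    LipschitzWith 1 (phi ν) := by
  refine LipschitzWith.of_dist_le_mul fun x y => ?_
  rw [Real.dist_eq, phi_sub_phi hν, NNReal.coe_one, dist_comm, Real.dist_eq, ← Real.norm_eq_abs]
  refine intervalIntegral.norm_integral_le_of_norm_le_const fun u _ => ?_
  rw [Real.norm_of_nonneg (sub_nonneg.mpr (cdf_le_one ν u))]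
  linarith [cdf_nonneg ν u]

theorem hasDerivWithinAt_phi (hν : Integrable (fun x : ℝ => max x 0) ν) (x : ℝ) :
    HasDerivWithinAt (phi ν) (-(1 - cdf ν x)) (Ioi x) x := by
  have hc : ContinuousWithinAt (fun u => 1 - cdf ν u) (Ioi x) x :=
    continuousWithinAt_const.sub (((cdf ν).right_continuous x).mono Ioi_subset_Ici_self)
  have hm : Measurable fun u => 1 - cdf ν u := measurable_const.sub (monotone_cdf ν).measurable
  have h := intervalIntegral.integral_hasDerivWithinAt_right (s := Ici x) (t := Ioi x)
    (intervalIntegrable_one_sub_cdf (ν := ν) x x)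
    hm.stronglyMeasurable.stronglyMeasurableAtFilter hc
  refine ((h.const_sub (phi ν x)).mono Ioi_subset_Ici_self).congr_of_eventuallyEq
    (.of_forall fun y => ?_) (by simp)
  simp only [← phi_sub_phi hν, sub_sub_cancel]

theorem phi_pos (hν : Integrable (fun x : ℝ => max x 0) ν) {x : ℝ}
    (hx : (x : EReal) < offerSup ν) : 0 < phi ν x := by
  obtain ⟨_, ⟨y, hy, rfl⟩, hxy⟩ := lt_sSup_iff.mp hx
  have hxy : x < y := EReal.coe_lt_coe_iff.mp hxy
  have h1 : ∫ _ in x..y, (1 - cdf ν y) ≤ ∫ u in x..y, (1 - cdf ν u) :=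
    intervalIntegral.integral_mono_on hxy.le intervalIntegrable_const
      (intervalIntegrable_one_sub_cdf x y)
      fun u hu => sub_le_sub_left (monotone_cdf ν hu.2) 1
  rw [intervalIntegral.integral_const, ← phi_sub_phi hν, smul_eq_mul] at h1
  have h2 : 0 < (y - x) * (1 - cdf ν y) := mul_pos (sub_pos.mpr hxy) (sub_pos.mpr hy)
  linarith [phi_nonneg (ν := ν) y]

theorem hasDerivWithinAt_phi_comp (hν : Integrable (fun x : ℝ => max x 0) ν) {m : ℝ → ℝ}
    (hm : Monotone m) {s m' : ℝ} (hs : HasDerivAt m m' s) :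
    HasDerivWithinAt (fun u => phi ν (m u)) (-(1 - cdf ν (m s)) * m') (Ioi s) s := by
  rw [hasDerivWithinAt_Ioi_iff_Ici]
  exact (hasDerivWithinAt_Ioi_iff_Ici.mp (hasDerivWithinAt_phi hν (m s))).comp s
    hs.hasDerivWithinAt fun _ hu => hm hu

end Phi

/-! ### The differential equation of the optimal value -/

/-- `m` solves `m' = rate * φ(m)`, `m(0) = μ₀` on `[0, t]`, and is extended to `ℝ` as a continuous
monotone function with the value `μ₀` at negative times. This is the curve of optimal values. -/
structure IsValueCurve (rate : ℝ) (ν : Measure ℝ) (μ₀ t : ℝ) (m : ℝ → ℝ) : Prop where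
  continuous : Continuous m
  eq_of_nonpos : ∀ s ≤ 0, m s = μ₀
  hasDerivAt : ∀ s ∈ Ioo 0 t, HasDerivAt m (rate * phi ν (m s)) s
  monotone : Monotone m
  strictMonoOn : StrictMonoOn m (Icc 0 t)
  phi_pos : ∀ s, 0 < phi ν (m s)

namespace IsValueCurve

variable {ν : Measure ℝ} {rate μ₀ t : ℝ} {m : ℝ → ℝ}

theorem mono (hm : IsValueCurve rate ν μ₀ t m) {s : ℝ} (hs : s ≤ t) :
    IsValueCurve rate ν μ₀ s m where
  continuous := hm.continuous
  eq_of_nonpos := hm.eq_of_nonpos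
  hasDerivAt u hu := hm.hasDerivAt u ⟨hu.1, hu.2.trans_le hs⟩
  monotone := hm.monotone
  strictMonoOn := hm.strictMonoOn.mono (Icc_subset_Icc_right hs)
  phi_pos := hm.phi_pos

theorem le_apply (hm : IsValueCurve rate ν μ₀ t m) (s : ℝ) : μ₀ ≤ m s := by
  rw [← hm.eq_of_nonpos (min s 0) (min_le_right _ _)]
  exact hm.monotone (min_le_left _ _)

/-- The change of variables `w = m r`. -/
theorem integral_one_div_phi_sq (hrate : 0 < rate) (hm : IsValueCurve rate ν μ₀ t m) {s : ℝ}
    (hs : s ∈ Icc 0 t) :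
    ∫ w in μ₀..m s, 1 / phi ν w ^ 2 = rate * ∫ r in (0 : ℝ)..s, 1 / phi ν (m r) := by
  have h := intervalIntegral.integral_comp_mul_deriv_of_deriv_nonneg (a := 0) (b := s)
    (f := m) (f' := fun r => rate * phi ν (m r)) (g := fun w => 1 / phi ν w ^ 2)
    hm.continuous.continuousOn
    (fun r hr => by
      rw [min_eq_left hs.1, max_eq_right hs.1] at hr
      exact hm.hasDerivAt r ⟨hr.1, hr.2.trans_le hs.2⟩)
    (fun r _ => (mul_pos hrate (hm.phi_pos r)).le)
  rw [hm.eq_of_nonpos 0 le_rfl] at h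
  rw [← h, ← intervalIntegral.integral_const_mul]
  refine intervalIntegral.integral_congr fun r _ => ?_
  have := (hm.phi_pos r).ne'
  simp only [Function.comp_apply]
  field_simp

end IsValueCurve

variable {ν : Measure ℝ} [IsProbabilityMeasure ν] {rate μ₀ t : ℝ}

theorem exists_isValueCurve (hrate : 0 < rate) (hν : Integrable (fun x : ℝ => max x 0) ν)
    (hμ₀ : (μ₀ : EReal) < offerSup ν) (ht : 0 ≤ t) : ∃ m, IsValueCurve rate ν μ₀ t m := by
  have hφ0 : 0 < phi ν μ₀ := phi_pos hν hμ₀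
  -- Above `μ₀` the field is bounded by `rate * φ(μ₀)`, so that a single Picard interval suffices.
  have hPL : IsPicardLindelof (fun _ x => rate * phi ν (max x μ₀)) (⟨0, le_rfl, ht⟩ : Icc 0 t) μ₀
      (Real.toNNReal (rate * phi ν μ₀ * t)) 0 (Real.toNNReal (rate * phi ν μ₀))
      (Real.toNNReal rate) := by
    have hpos : 0 ≤ rate * phi ν μ₀ := (mul_pos hrate hφ0).le
    refine ⟨fun _ _ => ?_, fun _ _ => continuousOn_const, fun _ _ x _ => ?_, ?_⟩
    · refine LipschitzWith.lipschitzOnWith (LipschitzWith.of_dist_le_mul fun x y => ?_)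
      rw [Real.coe_toNNReal _ hrate.le, Real.dist_eq, ← mul_sub, abs_mul, abs_of_pos hrate]
      refine mul_le_mul_of_nonneg_left ?_ hrate.le
      have h1 := (lipschitzWith_phi hν).dist_le_mul (max x μ₀) (max y μ₀)
      rw [Real.dist_eq, NNReal.coe_one, one_mul, Real.dist_eq] at h1
      exact h1.trans (abs_max_sub_max_le_abs x y μ₀)
    · rw [Real.coe_toNNReal _ hpos, Real.norm_of_nonneg (mul_nonneg hrate.le (phi_nonneg _))]
      exact mul_le_mul_of_nonneg_left (antitone_phi hν (le_max_right _ _)) hrate.le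
    · rw [Real.coe_toNNReal _ hpos, Real.coe_toNNReal _ (mul_nonneg hpos ht)]
      simp [ht]
  obtain ⟨a, ha0, ha⟩ := hPL.exists_eq_forall_mem_Icc_hasDerivWithinAt₀
  simp only at ha0
  have hac : ContinuousOn a (Icc 0 t) := fun s hs => (ha s hs).continuousWithinAt
  have had : ∀ s ∈ Ioo 0 t, HasDerivAt a (rate * phi ν (max (a s) μ₀)) s := fun s hs =>
    (ha s (Ioo_subset_Icc_self hs)).hasDerivAt (Icc_mem_nhds hs.1 hs.2)
  have hmono : MonotoneOn a (Icc 0 t) := by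
    refine monotoneOn_of_deriv_nonneg (convex_Icc 0 t) hac (fun s hs => ?_) fun s hs => ?_
    · rw [interior_Icc] at hs
      exact (had s hs).differentiableAt.differentiableWithinAt
    · rw [interior_Icc] at hs
      rw [(had s hs).deriv]
      exact mul_nonneg hrate.le (phi_nonneg _)
  have hge : ∀ s ∈ Icc 0 t, μ₀ ≤ a s := fun s hs => by
    rw [← ha0]; exact hmono ⟨le_rfl, ht⟩ hs hs.1
  have had' : ∀ s ∈ Ioo 0 t, HasDerivAt a (rate * phi ν (a s)) s := fun s hs => by
    simpa [max_eq_left (hge s (Ioo_subset_Icc_self hs))] using had s hs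
  have hclamp : ∀ s, max 0 (min s t) ∈ Icc 0 t := fun s =>
    ⟨le_max_left _ _, max_le ht (min_le_right _ _)⟩
  set m : ℝ → ℝ := fun s => a (max 0 (min s t)) with hm_def
  have hma : ∀ s ∈ Icc 0 t, m s = a s := fun s hs => by
    simp only [hm_def, min_eq_left hs.2, max_eq_right hs.1]
  have hmc : Continuous m := hac.comp_continuous (by fun_prop) hclamp
  have hmm : Monotone m := fun x y hxy => hmono (hclamp x) (hclamp y)
    (max_le_max_left 0 (min_le_min_right t hxy))
  have hm0 : ∀ s ≤ 0, m s = μ₀ := fun s hs => by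
    simp only [hm_def, max_eq_left ((min_le_left s t).trans hs), ha0]
  have hmd : ∀ s ∈ Ioo 0 t, HasDerivAt m (rate * phi ν (m s)) s := fun s hs => by
    rw [hma s (Ioo_subset_Icc_self hs)]
    refine (had' s hs).congr_of_eventuallyEq ?_
    filter_upwards [Icc_mem_nhds hs.1 hs.2] with u hu using hma u hu
  -- `exp (rate * s) * φ(m s)` is nondecreasing, since the slope of `φ` is at least `-1`.
  have hpos : ∀ s, 0 < phi ν (m s) := by
    intro s
    have hs := hclamp s
    set u := max 0 (min s t)
    have hms : m s = m u := (hma u hs).symm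
    have hc : Continuous fun v => Real.exp (rate * v) * phi ν (m v) :=
      (by fun_prop : Continuous fun v => Real.exp (rate * v)).mul
        ((lipschitzWith_phi hν).continuous.comp hmc)
    have key := intervalIntegral.integral_le_sub_of_hasDeriv_right_of_le hs.1 hc.continuousOn
      (g' := fun v => Real.exp (rate * v) * rate * phi ν (m v) +
        Real.exp (rate * v) * (-(1 - cdf ν (m v)) * (rate * phi ν (m v))))
      (fun v hv => by
        have h1 : HasDerivAt (fun v => Real.exp (rate * v)) (Real.exp (rate * v) * rate) v := by
          simpa using ((hasDerivAt_id v).const_mul rate).exp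
        exact h1.hasDerivWithinAt.mul
          (hasDerivWithinAt_phi_comp hν hmm (hmd v ⟨hv.1, hv.2.trans_le hs.2⟩)))
      (φ := fun _ => 0) integrableOn_zero (fun v _ => by
        have : Real.exp (rate * v) * rate * phi ν (m v) +
            Real.exp (rate * v) * (-(1 - cdf ν (m v)) * (rate * phi ν (m v))) =
            Real.exp (rate * v) * rate * phi ν (m v) * cdf ν (m v) := by ring
        rw [this]
        exact mul_nonneg (mul_nonneg (mul_nonneg (Real.exp_pos _).le hrate.le) (phi_nonneg _))
          (cdf_nonneg ν _))
    simp only [intervalIntegral.integral_zero, mul_zero, Real.exp_zero, one_mul, hm0 0 le_rfl]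
      at key
    rw [hms]
    exact pos_of_mul_pos_right (hφ0.trans_le (sub_nonneg.mp key)) (Real.exp_pos _).le
  refine ⟨m, hmc, hm0, hmd, hmm, ?_, hpos⟩
  refine strictMonoOn_of_deriv_pos (convex_Icc 0 t) hmc.continuousOn fun s hs => ?_
  rw [interior_Icc] at hs
  rw [(hmd s hs).deriv]
  exact mul_pos hrate (hpos s)

/-- Conditioning on the first arrival: a function that solves `h' = rate * (f - h)` on `(0, s)` is
the expectation of `f` at the remaining time at the next arrival, with the initial value `h 0` if
the deadline comes first. The equation is stated for right derivatives and with a function `f'`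
that agrees with `f` almost everywhere. -/
theorem integral_expMeasure_step (hrate : 0 < rate) {h f f' : ℝ → ℝ} {s : ℝ} (hs : 0 ≤ s)
    (hc : ContinuousOn h (Icc 0 s))
    (hd : ∀ u ∈ Ioo 0 s, HasDerivWithinAt h (rate * (f' u - h u)) (Ioi u) u)
    (hf' : IntervalIntegrable f' volume 0 s)
    (hff' : ∀ᵐ u, u ∈ uIoc 0 s → f' u = f u) :
    ∫ d, (if s - d ≤ 0 then h 0 else f (s - d)) ∂(expMeasure rate) = h s := by
  have hf : IntervalIntegrable f volume 0 s :=
    hf'.congr_ae ((ae_restrict_iff' measurableSet_uIoc).mpr hff')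
  set g : ℝ → ℝ := fun d => if s - d ≤ 0 then h 0 else f (s - d) with hg
  have h1 : ∫ d, g d ∂(expMeasure rate) =
      ∫ d in Ioi 0, rate * Real.exp (-rate * d) * g d := by
    have hpdf : gammaPDF 1 rate = exponentialPDF rate := rfl
    rw [expMeasure, gammaMeasure, hpdf, integral_withDensity_eq_integral_toReal_smul
      (f := exponentialPDF rate) (measurable_exponentialPDFReal rate).ennreal_ofReal
      (.of_forall fun _ => ENNReal.ofReal_lt_top),
      ← integral_Ici_eq_integral_Ioi, ← integral_indicator measurableSet_Ici]
    refine integral_congr_ae (.of_forall fun d => ?_)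
    simp only [exponentialPDF_eq, indicator, mem_Ici, smul_eq_mul]
    split_ifs with hd0
    · rw [ENNReal.toReal_ofReal (by positivity), neg_mul]
    · simp
  have hG1 : ∀ d ∈ Ioo 0 s, rate * Real.exp (-rate * d) * g d =
      rate * Real.exp (-rate * d) * f (s - d) := fun d hd => by
    simp [hg, hd.2]
  have hG2 : ∀ d ∈ Ioi s, rate * Real.exp (-rate * d) * g d =
      Real.exp (-rate * d) * (rate * h 0) := fun d hd => by
    simp only [hg, if_pos (sub_nonpos.mpr (mem_Ioi.mp hd).le)]; ring
  have hcont : Continuous fun d : ℝ => rate * Real.exp (-rate * d) := by fun_prop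
  have hi1 : IntervalIntegrable (fun d => rate * Real.exp (-rate * d) * f (s - d)) volume 0 s := by
    have := hf.comp_sub_left s
    simp only [sub_zero, sub_self] at this
    exact this.symm.continuousOn_mul hcont.continuousOn
  have hint1 : IntegrableOn (fun d => rate * Real.exp (-rate * d) * g d) (Ioc 0 s) := by
    rw [integrableOn_Ioc_iff_integrableOn_Ioo]
    rw [intervalIntegrable_iff_integrableOn_Ioo_of_le hs] at hi1
    exact hi1.congr_fun (fun d hd => (hG1 d hd).symm) measurableSet_Ioo
  have hint2 : IntegrableOn (fun d => rate * Real.exp (-rate * d) * g d) (Ioi s) :=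
    IntegrableOn.congr_fun ((exp_neg_integrableOn_Ioi s hrate).mul_const _)
      (fun d hd => (hG2 d hd).symm) measurableSet_Ioi
  have h2 : ∫ d in Ioi s, rate * Real.exp (-rate * d) * g d = Real.exp (-rate * s) * h 0 := by
    rw [setIntegral_congr_fun measurableSet_Ioi hG2, integral_mul_const,
      integral_exp_mul_Ioi (neg_lt_zero.mpr hrate)]
    field_simp
  have h3 : ∫ d in Ioc 0 s, rate * Real.exp (-rate * d) * g d =
      Real.exp (-rate * s) * ∫ u in (0 : ℝ)..s, rate * Real.exp (rate * u) * f u := by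
    rw [integral_Ioc_eq_integral_Ioo, setIntegral_congr_fun measurableSet_Ioo hG1,
      ← integral_Ioc_eq_integral_Ioo, ← intervalIntegral.integral_of_le hs,
      ← intervalIntegral.integral_const_mul]
    have := intervalIntegral.integral_comp_sub_left (a := 0) (b := s)
      (fun u => Real.exp (-rate * s) * (rate * Real.exp (rate * u) * f u)) s
    rw [sub_zero, sub_self] at this
    rw [← this]
    refine intervalIntegral.integral_congr fun d _ => ?_
    have : Real.exp (-rate * d) = Real.exp (-rate * s) * Real.exp (rate * (s - d)) := by
      rw [← Real.exp_add]; ring_nf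
    simp only [this]
    ring
  -- `exp (rate * u) * h u` has the right derivative `rate * exp (rate * u) * f' u`.
  have h4 : ∫ u in (0 : ℝ)..s, rate * Real.exp (rate * u) * f u =
      Real.exp (rate * s) * h s - h 0 := by
    have := intervalIntegral.integral_eq_sub_of_hasDeriv_right_of_le
      (f := fun u => Real.exp (rate * u) * h u)
      (f' := fun u => rate * Real.exp (rate * u) * f' u) hs
      ((by fun_prop : Continuous fun u => Real.exp (rate * u)).continuousOn.mul hc)
      (fun u hu => by
        have h1 : HasDerivAt (fun v => Real.exp (rate * v)) (Real.exp (rate * u) * rate) u := by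
          simpa using ((hasDerivAt_id u).const_mul rate).exp
        refine (h1.hasDerivWithinAt.mul (hd u hu)).congr_deriv ?_
        ring)
      (hf'.continuousOn_mul (by fun_prop))
    simp only [mul_zero, Real.exp_zero, one_mul] at this
    rw [← this]
    refine intervalIntegral.integral_congr_ae ?_
    filter_upwards [hff'] with u hu hmem
    rw [hu hmem]
  rw [h1, ← Ioc_union_Ioi_eq_Ioi hs, setIntegral_union (Ioc_disjoint_Ioi le_rfl) measurableSet_Ioi
    hint1 hint2, h2, h3, h4]
  have : Real.exp (-rate * s) * Real.exp (rate * s) = 1 := by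
    rw [← Real.exp_add]; simp
  linear_combination h s * this

end Bidding

namespace Bidding

/-! ### Value functions of the price and of the time to sale -/

variable {ν : Measure ℝ} {rate μ₀ t : ℝ} {m : ℝ → ℝ}

/-- The expected value of `k` at the remaining time at the sale, for the threshold policy of `m`,
where `k'` is the derivative of `k`. The quotient `φ(m s) / φ(m r)` is the probability that an
asset with remaining time `s` is still unsold at remaining time `r`. -/
noncomputable def timeValue (ν : Measure ℝ) (m k k' : ℝ → ℝ) (s : ℝ) : ℝ :=
  k s - phi ν (m s) * ∫ r in (0 : ℝ)..s, k' r / phi ν (m r)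

/-- The outcome of one step for the threshold policy of `m` and the reward `k`. -/
noncomputable def timeStep (ν : Measure ℝ) (m k k' : ℝ → ℝ) (q : ℝ × (ℝ × ℝ)) : ℝ :=
  if q.1 - q.2.1 ≤ 0 then k 0 else
    if m (q.1 - q.2.1) ≤ q.2.2 then k (q.1 - q.2.1) else timeValue ν m k k' (q.1 - q.2.1)

/-- The reward of the price: the mean residual price at the deadline, and the offer before. -/
noncomputable def priceReward (μ₀ : ℝ) (p : ℝ × ℝ) : ℝ := if p.1 = 0 then μ₀ else p.2

/-- The price obtained if, at remaining time `s - d`, the larger of the offer and the value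
`m (s - d)` is taken. -/
noncomputable def priceStep (μ₀ : ℝ) (m : ℝ → ℝ) (q : ℝ × (ℝ × ℝ)) : ℝ :=
  if q.1 - q.2.1 ≤ 0 then μ₀ else m (q.1 - q.2.1) + max (q.2.2 - m (q.1 - q.2.1)) 0

theorem measurable_priceReward : Measurable (priceReward μ₀) :=
  Measurable.ite (measurable_fst (measurableSet_singleton 0)) measurable_const measurable_snd

theorem measurable_priceStep (hm : Measurable m) : Measurable (priceStep μ₀ m) := by
  refine Measurable.ite (measurableSet_le (by fun_prop) measurable_const) measurable_const ?_
  fun_prop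

theorem IsValueCurve.abs_priceStep_le (hm : IsValueCurve rate ν μ₀ t m) (hμ₀ : 0 ≤ μ₀) {s d x : ℝ}
    (hs : s ∈ Icc 0 t) (hd : 0 ≤ d) : |priceStep μ₀ m (s, d, x)| ≤ m t + max x 0 := by
  have h1 := hm.le_apply t
  have h2 := hm.le_apply (s - d)
  have h3 : m (s - d) ≤ m t := hm.monotone (by linarith [hs.2])
  have h4 := le_max_right x 0
  simp only [priceStep]
  split_ifs
  · rw [abs_of_nonneg hμ₀]; linarith
  · have h5 := le_max_right (x - m (s - d)) 0
    rw [abs_of_nonneg (by linarith), ← max_add_add_left]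
    refine max_le ?_ (by linarith)
    linarith [le_max_left x 0]

variable [IsProbabilityMeasure ν]

/-- The expectation over one step: integrate over the offer first, then over the duration. -/
theorem integral_step_eq (hrate : 0 < rate) (hν : Integrable (fun x : ℝ => max x 0) ν)
    {Φ : ℝ × (ℝ × ℝ) → ℝ} (hΦ : Measurable Φ) {C s : ℝ} (hs : 0 ≤ s)
    (hb : ∀ d ≥ 0, ∀ x, |Φ (s, d, x)| ≤ C + max x 0) {h f f' : ℝ → ℝ}
    (hin : ∀ d, ∫ x, Φ (s, d, x) ∂ν = if s - d ≤ 0 then h 0 else f (s - d))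
    (hc : ContinuousOn h (Icc 0 s))
    (hd : ∀ u ∈ Ioo 0 s, HasDerivWithinAt h (rate * (f' u - h u)) (Ioi u) u)
    (hf' : IntervalIntegrable f' volume 0 s) (hff' : ∀ᵐ u, u ∈ uIoc 0 s → f' u = f u) :
    ∫ p, Φ (s, p) ∂((expMeasure rate).prod ν) = h s := by
  have : IsProbabilityMeasure (expMeasure rate) := isProbabilityMeasure_expMeasure hrate
  have hint : Integrable (fun p : ℝ × ℝ => Φ (s, p)) ((expMeasure rate).prod ν) := by
    refine ((integrable_const C).add (hν.comp_snd (expMeasure rate))).mono'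
      (hΦ.comp measurable_prodMk_left).aestronglyMeasurable ?_
    have h0 : ∀ᵐ p : ℝ × ℝ ∂((expMeasure rate).prod ν), 0 ≤ p.1 := by
      refine Measure.quasiMeasurePreserving_fst.ae (p := fun d : ℝ => 0 ≤ d) ?_
      rw [ae_iff]
      simpa [Iio] using expMeasure_Iio_zero rate
    filter_upwards [h0] with p hp
    exact hb p.1 hp p.2
  rw [integral_prod _ hint]
  simp only [hin]
  exact integral_expMeasure_step hrate hs hc hd hf' hff'

namespace IsValueCurve

theorem integral_priceStep (hrate : 0 < rate) (hν : Integrable (fun x : ℝ => max x 0) ν)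
    (hm : IsValueCurve rate ν μ₀ t m) (hμ₀ : 0 ≤ μ₀) {s : ℝ} (hs : s ∈ Icc 0 t) :
    ∫ p, priceStep μ₀ m (s, p) ∂((expMeasure rate).prod ν) = m s := by
  refine integral_step_eq hrate hν (measurable_priceStep hm.continuous.measurable) hs.1
    (fun d hd x => hm.abs_priceStep_le hμ₀ hs hd) (f := fun u => m u + phi ν (m u))
    (f' := fun u => m u + phi ν (m u))
    (fun d => ?_) hm.continuous.continuousOn (fun u hu => ?_)
    (((hm.continuous.add ((lipschitzWith_phi hν).continuous.comp hm.continuous))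
      ).intervalIntegrable _ _) (.of_forall fun u _ => rfl)
  · simp only [priceStep]
    split_ifs
    · simp [hm.eq_of_nonpos 0 le_rfl]
    · rw [integral_add (integrable_const _) (integrable_max_sub hν _), phi_eq_integral_max]
      simp
  · refine (hm.hasDerivAt u ⟨hu.1, hu.2.trans_le hs.2⟩).hasDerivWithinAt.congr_deriv ?_
    ring

/-- No policy yields more than `m` in expectation. -/
theorem isUpperValue_price (hrate : 0 < rate) (hν : Integrable (fun x : ℝ => max x 0) ν)
    (hm : IsValueCurve rate ν μ₀ t m) (hμ₀ : 0 ≤ μ₀) (A : Set (ℝ × ℝ)) :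
    IsUpperValue rate ν A t (priceReward μ₀) m (priceStep μ₀ m) (m t) where
  measurable_value := hm.continuous.measurable
  measurable_step := measurable_priceStep hm.continuous.measurable
  abs_value_le s hs := by
    rw [abs_of_nonneg (hμ₀.trans (hm.le_apply s))]; exact hm.monotone hs.2
  abs_step_le s hs d hd x := hm.abs_priceStep_le hμ₀ hs hd
  integral_step s hs := hm.integral_priceStep hrate hν hμ₀ hs
  reward_le s hs d hd x _ := by
    rcases le_or_gt (s - d) 0 with h | h
    · simp [priceReward, priceStep, h]
    · simp only [priceReward, priceStep, max_eq_left h.le, h.ne', h.not_ge, if_false]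
      linarith [le_max_left (x - m (s - d)) 0]
  value_le s hs d hd x hgo := by
    have h : 0 < s - d := by
      by_contra h; exact hgo (.inl (max_eq_right (not_lt.mp h)))
    simp only [priceStep, max_eq_left h.le, h.not_ge, if_false]
    linarith [le_max_right (x - m (s - d)) 0]

/-- The threshold policy of `m` yields at least `m` in expectation. -/
theorem isUpperValue_neg_price (hrate : 0 < rate) (hν : Integrable (fun x : ℝ => max x 0) ν)
    (hm : IsValueCurve rate ν μ₀ t m) (hμ₀ : 0 ≤ μ₀) :
    IsUpperValue rate ν (thresholdPolicy m) t (-priceReward μ₀) (-m) (-priceStep μ₀ m) (m t) where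
  measurable_value := hm.continuous.measurable.neg
  measurable_step := (measurable_priceStep hm.continuous.measurable).neg
  abs_value_le s hs := by
    rw [Pi.neg_apply, abs_neg]
    exact (hm.isUpperValue_price hrate hν hμ₀ ∅).abs_value_le s hs
  abs_step_le s hs d hd x := by
    rw [Pi.neg_apply, abs_neg]; exact hm.abs_priceStep_le hμ₀ hs hd
  integral_step s hs := by
    simp only [Pi.neg_apply, integral_neg, hm.integral_priceStep hrate hν hμ₀ hs]
  reward_le s hs d hd x hend := by
    rcases le_or_gt (s - d) 0 with h | h
    · simp [priceReward, priceStep, h]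
    · have hx : m (s - d) ≤ x := by
        rw [max_eq_left h.le] at hend
        exact hend.resolve_left h.ne'
      simp only [Pi.neg_apply, priceReward, priceStep, max_eq_left h.le, h.ne', h.not_ge, if_false,
        max_eq_left (sub_nonneg.mpr hx)]
      linarith
  value_le s hs d hd x hgo := by
    have h : 0 < s - d := by
      by_contra h; exact hgo (.inl (max_eq_right (not_lt.mp h)))
    have hx : x ≤ m (s - d) := by
      rw [max_eq_left h.le] at hgo
      by_contra hx
      exact hgo (.inr (not_le.mp hx).le)
    simp only [Pi.neg_apply, priceStep, max_eq_left h.le, h.not_ge, if_false,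
      max_eq_right (sub_nonpos.mpr hx)]
    linarith

variable {k k' : ℝ → ℝ}

theorem continuous_div_phi (hν : Integrable (fun x : ℝ => max x 0) ν)
    (hm : IsValueCurve rate ν μ₀ t m) (hk' : Continuous k') :
    Continuous fun r => k' r / phi ν (m r) :=
  hk'.div ((lipschitzWith_phi hν).continuous.comp hm.continuous) fun r => (hm.phi_pos r).ne'

theorem hasDerivAt_integral_div_phi (hν : Integrable (fun x : ℝ => max x 0) ν)
    (hm : IsValueCurve rate ν μ₀ t m) (hk' : Continuous k') (s : ℝ) :
    HasDerivAt (fun s => ∫ r in (0 : ℝ)..s, k' r / phi ν (m r)) (k' s / phi ν (m s)) s :=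
  (hm.continuous_div_phi hν hk').integral_hasStrictDerivAt 0 s |>.hasDerivAt

theorem continuous_timeValue (hν : Integrable (fun x : ℝ => max x 0) ν)
    (hm : IsValueCurve rate ν μ₀ t m) (hk : Continuous k) (hk' : Continuous k') :
    Continuous (timeValue ν m k k') :=
  hk.sub (((lipschitzWith_phi hν).continuous.comp hm.continuous).mul
    (continuous_iff_continuousAt.mpr fun s =>
      (hm.hasDerivAt_integral_div_phi hν hk' s).continuousAt))

theorem measurable_timeStep (hν : Integrable (fun x : ℝ => max x 0) ν)
    (hm : IsValueCurve rate ν μ₀ t m) (hk : Continuous k) (hk' : Continuous k') :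
    Measurable (timeStep ν m k k') := by
  have h1 := hm.continuous.measurable
  have h2 := hk.measurable
  have h3 := (hm.continuous_timeValue hν hk hk').measurable
  exact Measurable.ite (measurableSet_le (by fun_prop) measurable_const) measurable_const
    (Measurable.ite (measurableSet_le (by fun_prop) (by fun_prop)) (by fun_prop) (by fun_prop))

/-- Since `m` is strictly increasing, the threshold is an atom of the offer distribution at
countably many times only. -/
theorem ae_measureReal_Ici_eq (hm : IsValueCurve rate ν μ₀ t m) :
    ∀ᵐ u, u ∈ Icc 0 t → ν.real (Ioi (m u)) = ν.real (Ici (m u)) := by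
  have hatoms : Set.Countable {x : ℝ | 0 < ν {y | y = x}} :=
    Measure.countable_meas_level_set_pos measurable_id
  have hS : Set.Countable {u | u ∈ Icc 0 t ∧ 0 < ν {y | y = m u}} := by
    refine countable_of_injective_of_countable_image
      (hm.strictMonoOn.injOn.mono fun u hu => hu.1) (hatoms.mono ?_)
    rintro _ ⟨u, hu, rfl⟩
    exact hu.2
  filter_upwards [hS.ae_notMem volume] with u hu hmem
  have h0 : ν {m u} = 0 := by
    by_contra hne
    exact hu ⟨hmem, pos_iff_ne_zero.mpr hne⟩
  exact measureReal_congr (Ioi_ae_eq_Ici' h0)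

theorem integral_timeStep (hrate : 0 < rate) (hν : Integrable (fun x : ℝ => max x 0) ν)
    (hm : IsValueCurve rate ν μ₀ t m) (hk : ∀ s, HasDerivAt k (k' s) s) (hk' : Continuous k')
    {C : ℝ} (hC : ∀ s ∈ Icc 0 t, ∀ d ≥ 0, ∀ x, |timeStep ν m k k' (s, d, x)| ≤ C)
    {s : ℝ} (hs : s ∈ Icc 0 t) :
    ∫ p, timeStep ν m k k' (s, p) ∂((expMeasure rate).prod ν) = timeValue ν m k k' s := by
  have hkc : Continuous k := continuous_iff_continuousAt.mpr fun s => (hk s).continuousAt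
  have hhc := hm.continuous_timeValue hν hkc hk'
  refine integral_step_eq hrate hν (hm.measurable_timeStep hν hkc hk') hs.1
    (fun d hd x => (hC s hs d hd x).trans (le_add_of_nonneg_right (le_max_right _ _)))
    (f := fun u => ν.real (Ici (m u)) * k u + (1 - ν.real (Ici (m u))) * timeValue ν m k k' u)
    (f' := fun u => (1 - cdf ν (m u)) * k u + cdf ν (m u) * timeValue ν m k k' u)
    (fun d => ?_) hhc.continuousOn (fun u hu => ?_) ?_ ?_
  · simp only [timeStep]
    split_ifs
    · simp [timeValue]
    · have : (fun x => if m (s - d) ≤ x then k (s - d) else timeValue ν m k k' (s - d)) =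
          fun x => (Ici (m (s - d))).indicator
            (fun _ => k (s - d) - timeValue ν m k k' (s - d)) x + timeValue ν m k k' (s - d) := by
        ext x
        by_cases hx : m (s - d) ≤ x <;> simp [hx]
      rw [this, integral_add ((integrable_const _).indicator measurableSet_Ici)
        (integrable_const _), integral_indicator_const _ measurableSet_Ici]
      simp only [integral_const, probReal_univ, smul_eq_mul]
      ring
  · have hu' : u ∈ Ioo 0 t := ⟨hu.1, hu.2.trans_le hs.2⟩
    have hφ := hasDerivWithinAt_phi_comp hν hm.monotone (hm.hasDerivAt u hu')
    refine ((hk u).hasDerivWithinAt.sub (hφ.mul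
      (hm.hasDerivAt_integral_div_phi hν hk' u).hasDerivWithinAt)).congr_deriv ?_
    have := (hm.phi_pos u).ne'
    simp only [timeValue]
    field_simp
    ring
  · have hF : IntervalIntegrable (fun u => cdf ν (m u)) volume 0 s :=
      ((monotone_cdf ν).comp hm.monotone).intervalIntegrable
    exact ((intervalIntegrable_const.sub hF).mul_continuousOn hkc.continuousOn).add
      (hF.mul_continuousOn hhc.continuousOn)
  · filter_upwards [hm.ae_measureReal_Ici_eq] with u hu hmem
    rw [uIoc_of_le hs.1] at hmem
    rw [← hu ⟨hmem.1.le, hmem.2.trans hs.2⟩, measureReal_Ioi_eq]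
    ring

theorem exists_isUpperValue_time (hrate : 0 < rate) (hν : Integrable (fun x : ℝ => max x 0) ν)
    (hm : IsValueCurve rate ν μ₀ t m) (hk : ∀ s, HasDerivAt k (k' s) s) (hk' : Continuous k') :
    ∃ C, IsUpperValue rate ν (thresholdPolicy m) t (fun p => k p.1) (timeValue ν m k k')
      (timeStep ν m k k') C := by
  have hkc : Continuous k := continuous_iff_continuousAt.mpr fun s => (hk s).continuousAt
  have hhc := hm.continuous_timeValue hν hkc hk'
  obtain ⟨C₁, h1⟩ := isCompact_Icc.exists_bound_of_continuousOn (hkc.continuousOn (s := Icc 0 t))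
  obtain ⟨C₂, h2⟩ := isCompact_Icc.exists_bound_of_continuousOn (hhc.continuousOn (s := Icc 0 t))
  have hC : ∀ s ∈ Icc 0 t, ∀ d ≥ 0, ∀ x, |timeStep ν m k k' (s, d, x)| ≤ max C₁ C₂ := by
    intro s hs d hd x
    simp only [timeStep]
    split_ifs with h3 h4
    · exact (h1 0 ⟨le_rfl, hs.1.trans hs.2⟩).trans (le_max_left _ _)
    · exact (h1 _ ⟨(not_le.mp h3).le, by linarith [hs.2]⟩).trans (le_max_left _ _)
    · exact (h2 _ ⟨(not_le.mp h3).le, by linarith [hs.2]⟩).trans (le_max_right _ _)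
  refine ⟨max C₁ C₂, hhc.measurable, hm.measurable_timeStep hν hkc hk',
    fun s hs => (h2 s hs).trans (le_max_right _ _),
    fun s hs d hd x => (hC s hs d hd x).trans (le_add_of_nonneg_right (le_max_right _ _)),
    fun s hs => hm.integral_timeStep hrate hν hk hk' hC hs, fun s hs d hd x hend => ?_,
    fun s hs d hd x hgo => ?_⟩
  · rcases le_or_gt (s - d) 0 with h | h
    · simp [timeStep, h]
    · rw [max_eq_left h.le] at hend ⊢
      have hx : m (s - d) ≤ x := hend.resolve_left h.ne'
      simp [timeStep, h.not_ge, hx]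
  · have h : 0 < s - d := by
      by_contra h; exact hgo (.inl (max_eq_right (not_lt.mp h)))
    rw [max_eq_left h.le] at hgo ⊢
    have hx : ¬ m (s - d) ≤ x := fun hx => hgo (.inr hx)
    simp [timeStep, h.not_ge, hx]

end IsValueCurve
end Bidding

namespace Bidding

/-! ### The optimal value -/

variable {Ω : Type*} [MeasurableSpace Ω] {P : Measure Ω} {rate : ℝ}
  {ν : Measure ℝ} {D X : ℕ → Ω → ℝ} {X₀ : Ω → ℝ} {A : Set (ℝ × ℝ)}
  {t μ₀ : ℝ} {m : ℝ → ℝ}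

namespace IsBidModel

/-- Only the values of the threshold on `[0, t]` matter for the time to sale. -/
theorem timeToSale_ae_eq (H : IsBidModel P rate ν D X X₀) (ht : 0 ≤ t) {μ : ℝ → ℝ}
    (hμ : ∀ s ∈ Icc 0 t, μ s = m s) :
    timeToSale (thresholdPolicy μ) D X t =ᵐ[P]
      finalReward (fun p => t - p.1) (thresholdPolicy m) D X t := by
  filter_upwards [H.ae_nonneg] with ω hω
  have hE : ∀ n, EndsAt (thresholdPolicy μ) D X t ω n ↔ EndsAt (thresholdPolicy m) D X t ω n := by
    intro n
    simp only [EndsAt, thresholdPolicy, mem_ofPred_eq, hμ _ (remainingTime_mem_Icc ht hω (n + 1))]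
  simp only [timeToSale, finalReward, endStep, hE]

variable [IsProbabilityMeasure P]

/-- The error made by replacing the residual price by its mean is integrable with mean zero, since
the residual price is independent of the event that the deadline is reached. -/
theorem salePrice_sub_finalReward (H : IsBidModel P rate ν D X X₀) (hA : MeasurableSet A)
    (hX₀ : Integrable X₀ P) (hμ₀ : μ₀ = ∫ ω, X₀ ω ∂P) :
    Integrable (salePrice A D X X₀ t - finalReward (priceReward μ₀) A D X t) P ∧
      ∫ ω, (salePrice A D X X₀ t - finalReward (priceReward μ₀) A D X t) ω ∂P = 0 := by
  set r : ℝ × ℝ → ℝ := fun p => if p.1 = 0 then 1 else 0 with hr_def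
  have hr : Measurable r :=
    Measurable.ite (measurable_fst (measurableSet_singleton 0)) measurable_const measurable_const
  have heq : salePrice A D X X₀ t - finalReward (priceReward μ₀) A D X t =
      fun ω => finalReward r A D X t ω * (X₀ ω - μ₀) := by
    ext ω
    simp only [Pi.sub_apply, salePrice, finalReward, priceReward, hr_def]
    split_ifs <;> simp
  have hRm : Measurable (finalReward r A D X t) :=
    measurable_finalReward hr hA H.measurable_duration H.measurable_offer
  have hindep : IndepFun (finalReward r A D X t) (fun ω => X₀ ω - μ₀) P := by
    let S : Set (ℕ ⊕ (ℕ ⊕ Unit)) := {Sum.inr (Sum.inr ())}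
    refine H.indepFun_of_disjoint (S := Sᶜ) (S' := S) disjoint_compl_left ?_ ?_
    · exact @measurable_finalReward Ω (partSigma D X X₀ Sᶜ) r hr A hA D X t
        (fun n => measurable_part (i := Sum.inl n) (by simp [S]))
        (fun n => measurable_part (i := Sum.inr (Sum.inl n)) (by simp [S]))
    · exact (measurable_part (D := D) (X := X) (X₀ := X₀) (i := Sum.inr (Sum.inr ()))
        (mem_singleton _)).sub_const μ₀
  have hXint : Integrable (fun ω => X₀ ω - μ₀) P := hX₀.sub (integrable_const _)
  rw [heq]
  constructor
  · refine hXint.bdd_mul (c := 1) hRm.aestronglyMeasurable (.of_forall fun ω => ?_)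
    simp only [finalReward, hr_def]
    split_ifs <;> simp
  · rw [hindep.integral_fun_mul_eq_mul_integral hRm.aestronglyMeasurable
      hXint.aestronglyMeasurable, integral_sub hX₀ (integrable_const _), ← hμ₀]
    simp

theorem integrable_salePrice_iff (H : IsBidModel P rate ν D X X₀) (hA : MeasurableSet A)
    (hX₀ : Integrable X₀ P) (hμ₀ : μ₀ = ∫ ω, X₀ ω ∂P) :
    Integrable (salePrice A D X X₀ t) P ↔
      Integrable (finalReward (priceReward μ₀) A D X t) P := by
  have h := (H.salePrice_sub_finalReward (t := t) hA hX₀ hμ₀).1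
  exact ⟨fun h1 => by simpa using h1.sub h, fun h1 => by simpa using h1.add h⟩

theorem integral_salePrice (H : IsBidModel P rate ν D X X₀) (hA : MeasurableSet A)
    (hX₀ : Integrable X₀ P) (hμ₀ : μ₀ = ∫ ω, X₀ ω ∂P)
    (hint : Integrable (salePrice A D X X₀ t) P) :
    ∫ ω, salePrice A D X X₀ t ω ∂P = ∫ ω, finalReward (priceReward μ₀) A D X t ω ∂P := by
  have h := (H.salePrice_sub_finalReward (t := t) hA hX₀ hμ₀).2
  simp only [Pi.sub_apply] at h
  rw [integral_sub hint ((H.integrable_salePrice_iff hA hX₀ hμ₀).mp hint)] at h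
  linarith

theorem ae_endsAt_endStep (H : IsBidModel P rate ν D X X₀) (hA : MeasurableSet A) (ht : 0 ≤ t) :
    ∀ᵐ ω ∂P, EndsAt A D X t ω (endStep A D X t ω) := by
  filter_upwards [(H.aecover_ended (t := t) hA ht).ae_eventually_mem] with ω hω
  obtain ⟨n, hn⟩ := hω.exists
  simp only [aliveSet, mem_compl_iff, mem_ofPred_eq, not_forall, not_not] at hn
  obtain ⟨k, -, hk⟩ := hn
  exact Nat.sInf_mem (s := {n | EndsAt A D X t ω n}) ⟨k, hk⟩

variable [IsProbabilityMeasure ν]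

/-- The optimal value is the solution of the differential equation. -/
theorem optimalValue_eq (H : IsBidModel P rate ν D X X₀)
    (hν : Integrable (fun x : ℝ => max x 0) ν) (hX₀ : Integrable X₀ P)
    (hμ₀ : μ₀ = ∫ ω, X₀ ω ∂P) (hμ₀_nonneg : 0 ≤ μ₀) (hm : IsValueCurve rate ν μ₀ t m)
    (ht : 0 ≤ t) : optimalValue P D X X₀ t = m t := by
  have hrate := H.rate_pos
  have hle : ∀ A : Set (ℝ × ℝ), MeasurableSet A → Integrable (salePrice A D X X₀ t) P →
      ∫ ω, salePrice A D X X₀ t ω ∂P ≤ m t := fun A hA hint => by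
    rw [H.integral_salePrice hA hX₀ hμ₀ hint]
    exact H.integral_finalReward_le hA ht hν (hm.isUpperValue_price hrate hν hμ₀_nonneg A)
      ((H.integrable_salePrice_iff hA hX₀ hμ₀).mp hint)
  have hA : MeasurableSet (thresholdPolicy m) :=
    measurableSet_le (hm.continuous.measurable.comp measurable_fst) measurable_snd
  -- Accepted offers exceed `μ₀ ≥ 0`, so the reward of the threshold policy is nonnegative.
  have hint : Integrable (finalReward (priceReward μ₀) (thresholdPolicy m) D X t) P := by
    refine H.integrable_finalReward hA ht hν
      (hm.isUpperValue_price hrate hν hμ₀_nonneg _) measurable_priceReward hμ₀_nonneg ?_ ?_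
    · filter_upwards [H.ae_endsAt_endStep hA ht] with ω hω
      simp only [finalReward, priceReward]
      split_ifs with h
      · exact hμ₀_nonneg
      · exact (hμ₀_nonneg.trans (hm.le_apply _)).trans (hω.resolve_left h)
    · refine .of_forall fun ω => ?_
      simp only [finalReward, priceReward]
      split_ifs
      · linarith [le_max_right (X (endStep (thresholdPolicy m) D X t ω) ω) 0]
      · linarith [le_max_left (X (endStep (thresholdPolicy m) D X t ω) ω) 0]
  have hint' := (H.integrable_salePrice_iff hA hX₀ hμ₀).mpr hint
  have hge : m t ≤ ∫ ω, salePrice (thresholdPolicy m) D X X₀ t ω ∂P := by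
    rw [H.integral_salePrice hA hX₀ hμ₀ hint']
    have h := H.integral_finalReward_le hA ht hν
      (hm.isUpperValue_neg_price hrate hν hμ₀_nonneg) hint.neg
    have h' : ∫ ω, finalReward (-priceReward μ₀) (thresholdPolicy m) D X t ω ∂P =
        -∫ ω, finalReward (priceReward μ₀) (thresholdPolicy m) D X t ω ∂P :=
      integral_neg _
    rw [h', Pi.neg_apply] at h
    linarith
  refine le_antisymm (csSup_le ⟨_, _, hA, hint', rfl⟩ ?_) (hge.trans (le_csSup ⟨m t, ?_⟩
    ⟨_, hA, hint', rfl⟩)) <;>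
  · rintro v ⟨B, hB, hBint, rfl⟩
    exact hle B hB hBint

/-! ### Moments of the time to sale -/

/-- The expectation of a function of the remaining time at the sale. -/
theorem integral_finalReward_time (H : IsBidModel P rate ν D X X₀)
    (hν : Integrable (fun x : ℝ => max x 0) ν) (hm : IsValueCurve rate ν μ₀ t m) (ht : 0 ≤ t)
    {k k' : ℝ → ℝ} (hk : ∀ s, HasDerivAt k (k' s) s) (hk' : Continuous k') :
    ∫ ω, finalReward (fun p => k p.1) (thresholdPolicy m) D X t ω ∂P = timeValue ν m k k' t := by
  have hA : MeasurableSet (thresholdPolicy m) :=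
    measurableSet_le (hm.continuous.measurable.comp measurable_fst) measurable_snd
  have hkc : Continuous k := continuous_iff_continuousAt.mpr fun s => (hk s).continuousAt
  have hint : Integrable (finalReward (fun p => k p.1) (thresholdPolicy m) D X t) P := by
    obtain ⟨C, hC⟩ := isCompact_Icc.exists_bound_of_continuousOn (hkc.continuousOn (s := Icc 0 t))
    refine Integrable.of_bound (C := C) (measurable_finalReward (hkc.measurable.comp measurable_fst)
      hA H.measurable_duration H.measurable_offer).aestronglyMeasurable ?_
    filter_upwards [H.ae_nonneg] with ω hω
    exact hC _ (remainingTime_mem_Icc ht hω _)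
  obtain ⟨C, hC⟩ := hm.exists_isUpperValue_time H.rate_pos hν hk hk'
  obtain ⟨C', hC'⟩ := hm.exists_isUpperValue_time (k := fun s => -k s) (k' := fun s => -k' s)
    H.rate_pos hν (fun s => (hk s).neg) hk'.neg
  refine le_antisymm (H.integral_finalReward_le hA ht hν hC hint) ?_
  have h := H.integral_finalReward_le hA ht hν hC' hint.neg
  have h' : ∫ ω, finalReward (fun p => -k p.1) (thresholdPolicy m) D X t ω ∂P =
      -∫ ω, finalReward (fun p => k p.1) (thresholdPolicy m) D X t ω ∂P :=
    integral_neg _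
  have h'' : timeValue ν m (fun s => -k s) (fun s => -k' s) t = -timeValue ν m k k' t := by
    simp only [timeValue, neg_div, intervalIntegral.integral_neg]
    ring
  rw [h', h''] at h
  linarith

end IsBidModel

namespace IsValueCurve

variable [IsProbabilityMeasure ν]

theorem integral_integral_one_div_phi (hrate : 0 < rate)
    (hν : Integrable (fun x : ℝ => max x 0) ν) (hm : IsValueCurve rate ν μ₀ t m) (ht : 0 ≤ t) :
    ∫ u in μ₀..m t, 1 / phi ν u * ∫ w in μ₀..u, 1 / phi ν w ^ 2 =
      rate ^ 2 * ∫ r in (0 : ℝ)..t, (t - r) / phi ν (m r) := by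
  have h := intervalIntegral.integral_comp_mul_deriv_of_deriv_nonneg (a := 0) (b := t)
    (f := m) (f' := fun r => rate * phi ν (m r))
    (g := fun u => 1 / phi ν u * ∫ w in μ₀..u, 1 / phi ν w ^ 2) hm.continuous.continuousOn
    (fun r hr => by
      rw [min_eq_left ht, max_eq_right ht] at hr
      exact hm.hasDerivAt r hr)
    (fun r _ => (mul_pos hrate (hm.phi_pos r)).le)
  rw [hm.eq_of_nonpos 0 le_rfl] at h
  set I : ℝ → ℝ := fun s => ∫ r in (0 : ℝ)..s, 1 / phi ν (m r) with hI
  have hId : ∀ s, HasDerivAt I (1 / phi ν (m s)) s :=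
    hm.hasDerivAt_integral_div_phi hν (k' := fun _ => 1) continuous_const
  have hIc : Continuous I := continuous_iff_continuousAt.mpr fun s => (hId s).continuousAt
  have h1 : ∫ r in (0 : ℝ)..t, ((fun u => 1 / phi ν u * ∫ w in μ₀..u, 1 / phi ν w ^ 2) ∘ m) r *
      (rate * phi ν (m r)) = rate ^ 2 * ∫ r in (0 : ℝ)..t, I r := by
    rw [← intervalIntegral.integral_const_mul]
    refine intervalIntegral.integral_congr fun r hr => ?_
    rw [uIcc_of_le ht] at hr
    have := (hm.phi_pos r).ne'
    simp only [Function.comp_apply, hm.integral_one_div_phi_sq hrate hr]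
    rw [hI]
    field_simp
  have h2c : Continuous fun r => (t - r) / phi ν (m r) :=
    hm.continuous_div_phi hν (by fun_prop)
  have h2i : IntervalIntegrable (fun r => (t - r) / phi ν (m r) - I r) volume 0 t :=
    (h2c.sub hIc).intervalIntegrable _ _
  -- Integration by parts, in the form of the derivative of `(t - s) * I s`.
  have h2 : ∫ r in (0 : ℝ)..t, ((t - r) / phi ν (m r) - I r) = 0 := by
    rw [intervalIntegral.integral_eq_sub_of_hasDerivAt (f := fun s => (t - s) * I s)
      (fun s _ => ?_) h2i]
    · simp [hI]
    · refine (((hasDerivAt_id s).const_sub t).mul (hId s)).congr_deriv ?_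
      simp only [id]
      ring
  rw [intervalIntegral.integral_sub (h2c.intervalIntegrable _ _) (hIc.intervalIntegrable _ _)] at h2
  rw [← h, h1, sub_eq_zero.mp h2]

end IsValueCurve
end Bidding

theorem mainTheorem7 {Ω : Type*} [MeasurableSpace Ω] (P : Measure Ω) [IsProbabilityMeasure P]
    (rate : ℝ) (hrate : 0 < rate)
    (ν : Measure ℝ) [IsProbabilityMeasure ν] (hν : Integrable (fun x : ℝ => max x 0) ν)
    (D X : ℕ → Ω → ℝ) (X₀ : Ω → ℝ)
    (hDm : ∀ n, Measurable (D n)) (hXm : ∀ n, Measurable (X n)) (hX₀m : Measurable X₀)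
    (hD : ∀ n, P.map (D n) = expMeasure rate) (hX : ∀ n, P.map (X n) = ν)
    (hX₀ : Integrable X₀ P)
    (hindep : iIndepFun (Sum.elim D (Sum.elim X (fun _ : Unit => X₀))) P)
    (μ₀ : ℝ) (hμ₀ : μ₀ = ∫ ω, X₀ ω ∂P) (hμ₀_nonneg : 0 ≤ μ₀)
    (hμ₀_lt : (μ₀ : EReal) < Bidding.offerSup ν)
    (μ : ℝ → ℝ) (hμ : μ = Bidding.optimalValue P D X X₀)
    (φ : ℝ → ℝ) (hφ : φ = Bidding.phi ν)
    (t : ℝ) (ht : 0 ≤ t)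
    (T : Ω → ℝ) (hT : T = Bidding.timeToSale (Bidding.thresholdPolicy μ) D X t) :
    MemLp T 2 P ∧
    (∫ ω, T ω ∂P) = 1 / rate * φ (μ t) * ∫ w in μ₀..μ t, 1 / φ w ^ 2 ∧
    variance T P = 1 / rate ^ 2 *
      (2 * φ (μ t) * (∫ u in μ₀..μ t, 1 / φ u * ∫ w in μ₀..u, 1 / φ w ^ 2) -
        (φ (μ t) * ∫ w in μ₀..μ t, 1 / φ w ^ 2) ^ 2) := by
  have H : Bidding.IsBidModel P rate ν D X X₀ := ⟨hrate, hDm, hXm, hX₀m, hD, hX, hindep⟩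
  obtain ⟨m, hm⟩ := Bidding.exists_isValueCurve hrate hν hμ₀_lt ht
  have hμm : ∀ s ∈ Icc 0 t, μ s = m s := fun s hs => by
    rw [hμ]
    exact H.optimalValue_eq hν hX₀ hμ₀ hμ₀_nonneg (hm.mono hs.2) hs.1
  have hae : T =ᵐ[P] Bidding.finalReward (fun p => t - p.1) (Bidding.thresholdPolicy m) D X t := by
    rw [hT]; exact H.timeToSale_ae_eq ht hμm
  have hA : MeasurableSet (Bidding.thresholdPolicy m) :=
    measurableSet_le (hm.continuous.measurable.comp measurable_fst) measurable_snd
  have hL : MemLp T 2 P := by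
    refine MemLp.of_bound (C := t) ((Bidding.measurable_finalReward (by fun_prop) hA hDm
      hXm).aestronglyMeasurable.congr hae.symm) ?_
    filter_upwards [hae, H.ae_nonneg] with ω h1 hω
    have h2 := Bidding.remainingTime_mem_Icc (D := D) ht hω
      (Bidding.endStep (Bidding.thresholdPolicy m) D X t ω + 1)
    rw [h1, Bidding.finalReward, Real.norm_of_nonneg (by linarith [h2.2])]
    linarith [h2.1]
  have hE1 : ∫ ω, T ω ∂P = Bidding.phi ν (m t) * ∫ r in (0 : ℝ)..t, 1 / Bidding.phi ν (m r) := by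
    rw [integral_congr_ae hae, H.integral_finalReward_time hν hm ht (k := fun s => t - s)
      (k' := fun _ => -1) (fun s => (hasDerivAt_id s).const_sub t) continuous_const]
    simp only [Bidding.timeValue, neg_div, intervalIntegral.integral_neg]
    ring
  have hE2 : ∫ ω, (T ^ 2) ω ∂P =
      2 * (Bidding.phi ν (m t) * ∫ r in (0 : ℝ)..t, (t - r) / Bidding.phi ν (m r)) := by
    have h2 : ∫ ω, (T ^ 2) ω ∂P = ∫ ω, Bidding.finalReward (fun p => (t - p.1) ^ 2)
        (Bidding.thresholdPolicy m) D X t ω ∂P := by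
      refine integral_congr_ae ?_
      filter_upwards [hae] with ω h1
      rw [Pi.pow_apply, h1]
      rfl
    rw [h2, H.integral_finalReward_time hν hm ht (k := fun s => (t - s) ^ 2)
      (k' := fun s => -(2 * (t - s))) (fun s => by
        refine (((hasDerivAt_id s).const_sub t).pow 2).congr_deriv ?_
        simp) (by fun_prop)]
    simp only [Bidding.timeValue, neg_div, mul_div_assoc, intervalIntegral.integral_neg,
      intervalIntegral.integral_const_mul]
    ring
  subst hφ
  rw [hμm t ⟨ht, le_rfl⟩, hm.integral_one_div_phi_sq hrate ⟨ht, le_rfl⟩,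
    hm.integral_integral_one_div_phi hrate hν ht]
  refine ⟨hL, ?_, ?_⟩
  · rw [hE1]
    field_simp
  · rw [variance_eq_sub hL, hE1, hE2]
    field_simp
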